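/- Let $n\ge 2$ be an integer and $\mu\in(0,1)$ with $\mu\ge 1-(1/n)^{1/(n-1)}$. There are $n$ boxes; each contains, independently, a reward that is $1$ with probability $\mu$ and $0$ with probability $1-\mu$. Each box commits to a signal about its reward, i.e. to a distribution on $[0,1]$ with mean $\mu$ of the posterior expected reward that a searcher sees upon inspecting the box; it is fully informative if this distribution is the prior $\mu\delta_1+(1-\mu)\delta_0$. A box maximizes the probability of being taken by the searcher, whose outside option is $0$ and who observes the chosen distributions. Frictionless game: the searcher sees all realizations at once and takes a box with the highest one, breaking ties uniformly. Her utility is the expected highest realization. Game with frictions $(\beta,c)$, where $\beta\le1$, $c\ge0$, and $\beta<1$ or $c>0$: the searcher inspects boxes one after another, each inspection costing $c$ and taking one period discounted by $\beta$, and may at any time stop and take an inspected box or the outside option. She uses, for every profile of distributions, a policy that maximizes her expected discounted utility and is fair: whenever she inspects a further box, it is uniformly distributed on the uninspected boxes with the highest reservation price, where the reservation price $z$ of a box with distribution $F$ solves $z=-c+\beta\int\max(z,x)\,dF(x)$; and whenever she stops after having inspected some box, she takes a uniformly chosen one among the inspected boxes with the highest realization. Equilibria (in pure strategies of the boxes)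 are profiles of distributions from which no box can profitably deviate. Then the frictionless game has a symmetric equilibrium, and there exist $\hat\beta<1$ and $\hat c>0$ such that for all $\beta\in(\hat\beta,1]$ and $c\in[0,\hat c)$ with $\beta<1$ or $c>0$: in the game with frictions $(\beta,c)$ there is a fair subgame perfect equilibrium in which every box is fully informative, and the searcher's expected discounted utility in every such equilibrium is strictly greater than her expected utility in every symmetric equilibrium of the frictionless game. -/

import Mathlib

open MeasureTheory

noncomputable section

namespace PandoraSearch

/-- A distribution of a box's posterior mean reward: a Borel probability measure on `[0,1]`. -/
abbrev Dist := ProbabilityMeasure unitInterval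

/-- The pure strategies of a box: all distributions on `[0,1]` with mean `μ`. -/
def feasible (μ : ℝ) : Set Dist :=
  {F | ∫ x, (x : ℝ) ∂(F : Measure unitInterval) = μ}

/-- The fully informative strategy, i.e. the prior itself: reward `1` with probability `μ`
and reward `0` with probability `1 - μ`. -/
def prior (μ : unitInterval) : Dist :=
  ⟨ENNReal.ofReal (μ : ℝ) • Measure.dirac 1 + ENNReal.ofReal (1 - (μ : ℝ)) • Measure.dirac 0, by
    constructor
    have h0 : (0 : ℝ) ≤ μ := μ.2.1
    have h1 : (0 : ℝ) ≤ 1 - μ := sub_nonneg.2 μ.2.2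
    simp [← ENNReal.ofReal_add h0 h1]⟩

/-! ### The game without frictions

The searcher sees all realizations at once and takes a box with the highest one, breaking ties
uniformly at random. -/

/-- The joint law of the independent rewards of the boxes. -/
def jointLaw {n : ℕ} (F : Fin n → Dist) : Measure (Fin n → unitInterval) :=
  Measure.pi fun i => (F i : Measure unitInterval)

open scoped Classical in
/-- The probability with which box `i` is taken at the realization `x`. -/
def winShare {n : ℕ} (i : Fin n) (x : Fin n → unitInterval) : ℝ :=
  if ∀ j, x j ≤ x i then
    1 / ((Finset.univ.filter fun k : Fin n => ∀ j, x j ≤ x k).card : ℝ)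
  else 0

/-- The payoff of box `i` without frictions: the probability that it is taken. -/
def frictionlessPayoff {n : ℕ} (F : Fin n → Dist) (i : Fin n) : ℝ :=
  ∫ x, winShare i x ∂(jointLaw F)

/-- The searcher's expected utility without frictions: the expected highest reward. -/
def frictionlessUtility {n : ℕ} (F : Fin n → Dist) : ℝ :=
  ∫ x, (⨆ i, (x i : ℝ)) ∂(jointLaw F)

/-- The profile `F` is an equilibrium of the game without frictions. -/
structure IsFrictionlessEquilibrium {n : ℕ} (μ : ℝ) (F : Fin n → Dist) : Prop where
  feasible_profile : ∀ i, F i ∈ feasible μ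
  no_deviation : ∀ i, ∀ G ∈ feasible μ,
    frictionlessPayoff (Function.update F i G) i ≤ frictionlessPayoff F i

/-! ### Sequential search with inspection cost `c` and discount factor `β` -/

/-- A (randomized) policy of the searcher. A state of the search is the set `O` of opened boxes
together with the rewards `x i` found in them; along the search the coordinates `x i` of closed
boxes are kept at `0` (see `outcome`), so they carry no information.
`visit O x i` is the probability of inspecting box `i` next, and `select O x i` is the probability
of stopping and taking box `i`. Only closed boxes can be inspected and only opened boxes can be
taken; the remaining probability is that of stopping with the outside option, which is worth `0`. -/
structure Policy (n : ℕ) where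
  visit : Finset (Fin n) → (Fin n → unitInterval) → Fin n → ℝ
  select : Finset (Fin n) → (Fin n → unitInterval) → Fin n → ℝ
  visit_nonneg : ∀ O x i, 0 ≤ visit O x i
  select_nonneg : ∀ O x i, 0 ≤ select O x i
  visit_opened : ∀ O x i, i ∈ O → visit O x i = 0
  select_closed : ∀ O x i, i ∉ O → select O x i = 0
  total_le_one : ∀ O x, ∑ i, visit O x i + ∑ i, select O x i ≤ 1
  measurable_visit : ∀ O i, Measurable fun x => visit O x i
  measurable_select : ∀ O i, Measurable fun x => select O x i

/-- The expectation, from the state `(O, x)` on and with at most `k` further inspections, of the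
terminal reward `g i (x i)` if box `i` is taken, where each inspection costs `c` at once
and takes one period, which is discounted by `β`. -/
def outcome {n : ℕ} (β c : ℝ) (g : Fin n → unitInterval → ℝ) (F : Fin n → Dist) (η : Policy n) :
    ℕ → Finset (Fin n) → (Fin n → unitInterval) → ℝ
  | 0, O, x => ∑ i, η.select O x i * g i (x i)
  | k + 1, O, x => ∑ i, η.select O x i * g i (x i) +
      ∑ i, η.visit O x i *
        (-c + β * ∫ y, outcome β c g F η k (insert i O) (Function.update x i y)
          ∂(F i : Measure unitInterval))

/-- The searcher's expected discounted utility from the policy `η` when the boxes' rewards are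
distributed according to `F`. -/
def searchUtility {n : ℕ} (β c : ℝ) (F : Fin n → Dist) (η : Policy n) : ℝ :=
  outcome β c (fun _ y => (y : ℝ)) F η n ∅ 0

/-- The payoff of box `i`: the (undiscounted) probability that it is taken in the end. -/
def selectionProb {n : ℕ} (F : Fin n → Dist) (η : Policy n) (i : Fin n) : ℝ :=
  outcome 1 0 (fun j _ => if j = i then 1 else 0) F η n ∅ 0

/-- `z` solves the equation of the reservation price,
`z = -c + β [∫_{x ≤ z} z dF + ∫_{x > z} x dF]`. -/
def IsReservationPrice (β c : ℝ) (F : Dist) (z : ℝ) : Prop :=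
  z = -c + β * ∫ x, max z (x : ℝ) ∂(F : Measure unitInterval)

/-- The reservation price of a box with distribution `F`. The equation has exactly one solution
if `0 < β ≤ 1`, `0 ≤ c`, not both `β = 1` and `c = 0`, and `c` is below `β` times the mean. -/
def reservationPrice (β c : ℝ) (F : Dist) : ℝ :=
  Classical.epsilon (IsReservationPrice β c F)

open scoped Classical in
/-- The closed boxes with the highest reservation price among all closed boxes. -/
def topClosed {n : ℕ} (β c : ℝ) (F : Fin n → Dist) (O : Finset (Fin n)) : Finset (Fin n) :=
  Finset.univ.filter fun i => i ∉ O ∧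
    ∀ j, j ∉ O → reservationPrice β c (F j) ≤ reservationPrice β c (F i)

open scoped Classical in
/-- The opened boxes with the highest reward among all opened boxes. -/
def bestOpened {n : ℕ} (O : Finset (Fin n)) (x : Fin n → unitInterval) : Finset (Fin n) :=
  O.filter fun i => ∀ j ∈ O, x j ≤ x i

/-- A fair policy: whenever the searcher inspects a further box, it is uniformly distributed on the
closed boxes with the highest reservation price; whenever she stops after having opened a box,
she takes a box that is uniformly distributed on the opened ones with the highest reward. -/
structure IsFair {n : ℕ} (β c : ℝ) (F : Fin n → Dist) (η : Policy n) : Prop where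
  visit_eq : ∀ O x, ∀ i ∈ topClosed β c F O,
    η.visit O x i = (∑ j, η.visit O x j) / ((topClosed β c F O).card : ℝ)
  select_eq : ∀ O x, ∀ i ∈ bestOpened O x,
    η.select O x i = (1 - ∑ j, η.visit O x j) / ((bestOpened O x).card : ℝ)

/-- Fair subgame perfect equilibrium in pure strategies of the game with inspection cost `c`
and discount factor `β`: the searcher responds to every feasible profile of distributions by an
optimal fair policy, and no box can raise its probability of being taken by a deviation, to which
the searcher responds as well. -/
structure IsFSPE {n : ℕ} (μ β c : ℝ) (η : (Fin n → Dist) → Policy n) (F : Fin n → Dist) :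
    Prop where
  feasible_profile : ∀ i, F i ∈ feasible μ
  optimal : ∀ H : Fin n → Dist, (∀ i, H i ∈ feasible μ) →
    ∀ η' : Policy n, searchUtility β c H η' ≤ searchUtility β c H (η H)
  fair : ∀ H : Fin n → Dist, (∀ i, H i ∈ feasible μ) → IsFair β c H (η H)
  no_deviation : ∀ i, ∀ G ∈ feasible μ,
    selectionProb (Function.update F i G) (η (Function.update F i G)) i ≤ selectionProb F (η F) i

end PandoraSearch

end

noncomputable section

namespace PandoraSearch

/-! ### Bounded measurable functions -/

/-! Without frictions full information is not an equilibrium: a box can beat rivals who show 0 by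
revealing slightly more than 0. With frictions, revealing everything makes a box attractive to
inspect first, and this incentive survives however small the frictions are.

Search. Let each box have slope 1 above its reservation price and `β` times its distribution
function below it. The value of search with closed boxes `C` and best reward `y` is 1 minus the
integral over `[y, 1]` of the product of the slopes of `C`. Comparing this with the value of
inspecting one box first shows that no policy does better and that the index policy attains it
(`visit_le_value`, `visit_eq_value`). Among distributions with mean `μ` the prior alone has the
highest reservation price, because `max z x` lies strictly below its chord inside `(0, 1)`. A box
deviating from full information is therefore opened last, only after all others have shown 0, and is
taken with probability at most `(1 - μ) ^ (n - 1)`. The lower bound on `μ` says that this is at most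
`1 / n`, the equilibrium payoff (`exists_isFSPE`). As frictions vanish, the reservation price of the
prior tends to 1 and the searcher's utility to the first best `1 - (1 - μ) ^ n`
(`le_searchUtility_of_isFSPE`).

No frictions. A distribution against which reward `y` wins with probability at most `y / (n * μ)`
gives a symmetric equilibrium, and a power-law quantile with an atom at 1 has this property
(`exists_isFrictionlessEquilibrium`). In every symmetric equilibrium, deviations to two rewards, `s`
and 1, must not pay; this forces a fixed amount of mass into the interior of `[0, 1]`. Interior mass
makes the expected maximum fall short of `1 - (1 - μ) ^ n` by a `δ` that is the same for all these
equilibria (`exists_gap`). Small enough frictions cost the searcher less than `δ`. -/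

theorem integrable_of_mem_Icc {α : Type*} [MeasurableSpace α] {ν : Measure α} [IsFiniteMeasure ν]
    {f : α → ℝ} (hf : Measurable f) (h0 : ∀ a, 0 ≤ f a) (h1 : ∀ a, f a ≤ 1) : Integrable f ν :=
  Integrable.of_bound hf.aestronglyMeasurable 1
    (Filter.Eventually.of_forall fun a => by rw [Real.norm_of_nonneg (h0 a)]; exact h1 a)

theorem integrable_coe (F : Dist) : Integrable (fun x : unitInterval => (x : ℝ)) F :=
  integrable_of_mem_Icc measurable_subtype_coe (fun x => x.2.1) fun x => x.2.2

/-- No integrability of `f` is needed, since a non-integrable function has integral 0 by convention.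
This allows continuation outcomes to be bounded without proving them measurable. -/
theorem integral_le_integral_of_nonneg {α : Type*} [MeasurableSpace α] {ν : Measure α} {f g : α → ℝ}
    (hg : Integrable g ν) (h0 : ∀ a, 0 ≤ g a) (h : ∀ a, f a ≤ g a) :
    ∫ a, f a ∂ν ≤ ∫ a, g a ∂ν := by
  by_cases hf : Integrable f ν
  · exact integral_mono hf hg h
  · rw [integral_undef hf]
    exact integral_nonneg h0

theorem integral_Ici_one (y : unitInterval) :
    ∫ m : unitInterval, (if y ≤ m then (1 : ℝ) else 0) = 1 - y := by
  have : (fun m : unitInterval => if y ≤ m then (1 : ℝ) else 0) = (Set.Ici y).indicator 1 := by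
    ext m; simp [Set.indicator_apply]
  rw [this, integral_indicator_one measurableSet_Ici, Measure.real, unitInterval.volume_Ici,
    ENNReal.toReal_ofReal (sub_nonneg.2 y.2.2)]

/-! ### Distribution functions -/

/-- The cumulative distribution function on the unit interval. -/
def cumulative (F : Dist) (m : unitInterval) : ℝ := (F : Measure unitInterval).real (Set.Iic m)

theorem cumulative_nonneg (F : Dist) (m : unitInterval) : 0 ≤ cumulative F m := measureReal_nonneg

theorem cumulative_le_one (F : Dist) (m : unitInterval) : cumulative F m ≤ 1 := measureReal_le_one

theorem cumulative_mono (F : Dist) : Monotone (cumulative F) := fun _ _ h =>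
  measureReal_mono (Set.Iic_subset_Iic.2 h)

theorem measurable_cumulative (F : Dist) : Measurable (cumulative F) :=
  (cumulative_mono F).measurable

theorem integral_le_indicator (F : Dist) (m : unitInterval) :
    ∫ x : unitInterval, (if x ≤ m then (1 : ℝ) else 0) ∂(F : Measure unitInterval)
      = cumulative F m := by
  have : (fun x : unitInterval => if x ≤ m then (1 : ℝ) else 0) = (Set.Iic m).indicator 1 := by
    ext x; simp [Set.indicator_apply]
  rw [this, integral_indicator_one measurableSet_Iic, cumulative]

theorem measurable_ge_ite {P : unitInterval → ℝ} (hP : Measurable P) (y : unitInterval) :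
    Measurable fun m => if y ≤ m then P m else 0 :=
  Measurable.ite measurableSet_Ici hP measurable_const

/-- Fubini: `y ⊔ x ≤ m` splits into `y ≤ m` and `x ≤ m`, and averaging the latter over `x` gives the
distribution function. Opening a box thus multiplies the integrand of the value function by its
distribution function. -/
theorem integral_tail_max (F : Dist) {P : unitInterval → ℝ} (hP : Measurable P)
    (h0 : ∀ m, 0 ≤ P m) (h1 : ∀ m, P m ≤ 1) (y : unitInterval) :
    ∫ x, (∫ m, if y ⊔ x ≤ m then P m else 0) ∂(F : Measure unitInterval)
      = ∫ m, if y ≤ m then cumulative F m * P m else 0 := by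
  rw [integral_integral_swap]
  · refine integral_congr_ae (Filter.Eventually.of_forall fun m => ?_)
    by_cases hy : y ≤ m
    · simp only [sup_le_iff, hy, true_and, if_true]
      rw [← integral_le_indicator, ← integral_mul_const]
      refine integral_congr_ae (Filter.Eventually.of_forall fun x => ?_)
      simp
    · simp [hy]
  · refine integrable_of_mem_Icc ?_ ?_ ?_
    · refine Measurable.ite ?_ (hP.comp measurable_snd) measurable_const
      exact measurableSet_le (measurable_const.sup measurable_fst) measurable_snd
    · intro p
      simp only [Function.uncurry]
      split_ifs
      exacts [h0 _, le_rfl]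
    · intro p
      simp only [Function.uncurry]
      split_ifs
      exacts [h1 _, zero_le_one]

/-! ### Reservation prices -/

theorem integral_max_eq (F : Dist) (z : unitInterval) :
    ∫ x, max (z : ℝ) (x : ℝ) ∂(F : Measure unitInterval)
      = 1 - ∫ m, if z ≤ m then cumulative F m else 0 := by
  have h := integral_tail_max F (P := fun _ => 1) measurable_const (by simp) (by simp) z
  simp only [integral_Ici_one, mul_one] at h
  rw [← h]
  have : ∀ x : unitInterval, ((z ⊔ x : unitInterval) : ℝ) = max (z : ℝ) (x : ℝ) := fun x =>
    (Subtype.mono_coe _).map_max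
  simp only [this]
  rw [integral_sub (integrable_const _)]
  · simp
  · simp only [← this]
    exact integrable_of_mem_Icc
      (measurable_subtype_coe.comp (measurable_const.sup measurable_id))
      (fun x => (z ⊔ x).2.1) fun x => (z ⊔ x).2.2

theorem integrable_max (F : Dist) (z : ℝ) :
    Integrable (fun x : unitInterval => max z (x : ℝ)) F :=
  (integrable_const z).sup (integrable_coe F)

theorem exists_isReservationPrice {β c μ : ℝ} {F : Dist} (hF : F ∈ feasible μ)
    (hβ1 : β ≤ 1) (hc : 0 ≤ c) (hcμ : c < β * μ) : ∃ z, IsReservationPrice β c F z := by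
  -- The right-hand side of the price equation minus `z` is continuous, nonnegative at 0 and
  -- nonpositive at 1.
  have hcont : Continuous fun z : ℝ =>
      -c + β * ∫ x, max z (x : ℝ) ∂(F : Measure unitInterval) - z := by
    have : Continuous fun z : ℝ => ∫ x, max z (x : ℝ) ∂(F : Measure unitInterval) := by
      refine LipschitzWith.continuous (K := 1) (LipschitzWith.of_dist_le_mul fun a b => ?_)
      rw [Real.dist_eq, Real.dist_eq, ← integral_sub (integrable_max F a) (integrable_max F b)]
      have := norm_integral_le_of_norm_le_const (μ := (F : Measure unitInterval))
        (f := fun x : unitInterval => max a (x : ℝ) - max b (x : ℝ)) (C := |a - b|)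
        (Filter.Eventually.of_forall fun x => abs_max_sub_max_le_abs a b x)
      simpa using this
    fun_prop
  have h0 : 0 ≤ -c + β * ∫ x, max (0 : ℝ) (x : ℝ) ∂(F : Measure unitInterval) - 0 := by
    have : ∀ x : unitInterval, max (0 : ℝ) (x : ℝ) = x := fun x => max_eq_right x.2.1
    simp only [this]
    rw [show ∫ x : unitInterval, (x : ℝ) ∂(F : Measure unitInterval) = μ from hF]
    linarith
  have h1 : -c + β * ∫ x, max (1 : ℝ) (x : ℝ) ∂(F : Measure unitInterval) - 1 ≤ 0 := by
    have : ∀ x : unitInterval, max (1 : ℝ) (x : ℝ) = 1 := fun x => max_eq_left x.2.2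
    simp only [this]
    simp
    linarith
  obtain ⟨z, -, hz⟩ := intermediate_value_Icc' zero_le_one hcont.continuousOn ⟨h1, h0⟩
  exact ⟨z, by unfold IsReservationPrice; simp only at hz; linarith⟩

theorem isReservationPrice_reservationPrice {β c μ : ℝ} {F : Dist} (hF : F ∈ feasible μ)
    (hβ1 : β ≤ 1) (hc : 0 ≤ c) (hcμ : c < β * μ) :
    IsReservationPrice β c F (reservationPrice β c F) :=
  Classical.epsilon_spec (exists_isReservationPrice hF hβ1 hc hcμ)

theorem IsReservationPrice.pos {β c μ z : ℝ} {F : Dist} (hF : F ∈ feasible μ) (hβ : 0 < β)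
    (hcμ : c < β * μ) (hz : IsReservationPrice β c F z) : 0 < z := by
  have : μ ≤ ∫ x, max z (x : ℝ) ∂(F : Measure unitInterval) := by
    rw [← show ∫ x : unitInterval, (x : ℝ) ∂(F : Measure unitInterval) = μ from hF]
    exact integral_mono (integrable_coe F) (integrable_max F z) fun x => le_max_right _ _
  have := mul_le_mul_of_nonneg_left this hβ.le
  unfold IsReservationPrice at hz
  linarith

theorem IsReservationPrice.lt_one {β c z : ℝ} {F : Dist} (hβ1 : β ≤ 1) (hc : 0 ≤ c)
    (hβc : β < 1 ∨ 0 < c) (hz : IsReservationPrice β c F z) : z < 1 := by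
  by_contra! h
  have h2 : ∀ x : unitInterval, max z (x : ℝ) = z := fun x => max_eq_left (x.2.2.trans h)
  unfold IsReservationPrice at hz
  simp only [h2] at hz
  simp at hz
  rcases hβc with h3 | h3 <;> nlinarith

/-- The integrand of the reservation price equation, in terms of the distribution function. -/
def excess (β z : ℝ) (F : Dist) (m : unitInterval) : ℝ :=
  if z ≤ (m : ℝ) then 1 - β * cumulative F m else 0

theorem excess_nonneg {β : ℝ} (hβ : 0 < β) (hβ1 : β ≤ 1) (z : ℝ) (F : Dist) (m : unitInterval) :
    0 ≤ excess β z F m := by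
  unfold excess
  split_ifs
  · nlinarith [cumulative_nonneg F m, cumulative_le_one F m]
  · exact le_rfl

theorem excess_le_one {β : ℝ} (hβ : 0 < β) (z : ℝ) (F : Dist) (m : unitInterval) :
    excess β z F m ≤ 1 := by
  unfold excess
  split_ifs
  · nlinarith [cumulative_nonneg F m, cumulative_le_one F m]
  · exact zero_le_one

theorem measurable_excess (β z : ℝ) (F : Dist) : Measurable (excess β z F) :=
  Measurable.ite (measurableSet_le measurable_const measurable_subtype_coe)
    (measurable_const.sub ((measurable_cumulative F).const_mul β)) measurable_const

/-- The layer-cake formula `integral_max_eq` turns the price equation into this form: the gain from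
inspection above `z` exactly pays for the frictions `1 - β + c`. -/
theorem IsReservationPrice.integral_excess {β c z : ℝ} {F : Dist} (h0 : 0 ≤ z) (h1 : z ≤ 1)
    (hz : IsReservationPrice β c F z) : ∫ m, excess β z F m = 1 - β + c := by
  have h := integral_max_eq F ⟨z, h0, h1⟩
  have e : ∀ m : unitInterval, excess β z F m = (if (⟨z, h0, h1⟩ : unitInterval) ≤ m then 1 else 0)
      - β * (if (⟨z, h0, h1⟩ : unitInterval) ≤ m then cumulative F m else 0) := by
    intro m
    have : ((⟨z, h0, h1⟩ : unitInterval) ≤ m) ↔ z ≤ (m : ℝ) := Iff.rfl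
    simp only [excess, this]
    split_ifs <;> ring
  simp only [e]
  rw [integral_sub, integral_Ici_one, integral_const_mul]
  · unfold IsReservationPrice at hz
    simp only at h ⊢
    rw [h] at hz
    linarith
  · exact integrable_of_mem_Icc (measurable_ge_ite measurable_const _)
      (fun m => by split_ifs <;> simp) (fun m => by split_ifs <;> simp)
  · refine (integrable_of_mem_Icc (measurable_ge_ite (measurable_cumulative F) _)
      (fun m => ?_) (fun m => ?_)).const_mul β
    all_goals
      split_ifs
      first | exact cumulative_nonneg F m | exact cumulative_le_one F m
      simp

/-! ### The value function -/

/-- The derivative of the one-box value function with respect to the outside option. -/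
def slope (β z : ℝ) (F : Dist) (m : unitInterval) : ℝ :=
  if z ≤ (m : ℝ) then 1 else β * cumulative F m

theorem slope_nonneg {β : ℝ} (hβ : 0 < β) (z : ℝ) (F : Dist) (m : unitInterval) :
    0 ≤ slope β z F m := by
  unfold slope
  split_ifs
  · exact zero_le_one
  · exact mul_nonneg hβ.le (cumulative_nonneg F m)

theorem slope_le_one {β : ℝ} (hβ : 0 < β) (hβ1 : β ≤ 1) (z : ℝ) (F : Dist) (m : unitInterval) :
    slope β z F m ≤ 1 := by
  unfold slope
  split_ifs
  · exact le_rfl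
  · nlinarith [cumulative_nonneg F m, cumulative_le_one F m]

theorem measurable_slope (β z : ℝ) (F : Dist) : Measurable (slope β z F) :=
  Measurable.ite (measurableSet_le measurable_const measurable_subtype_coe) measurable_const
    ((measurable_cumulative F).const_mul β)

theorem slope_eq (β z : ℝ) (F : Dist) (m : unitInterval) :
    slope β z F m = excess β z F m + β * cumulative F m := by
  unfold slope excess
  split_ifs <;> ring

variable {n : ℕ}

/-- The product of the slopes of the boxes in `C`. -/
def slopeProd (β : ℝ) (z : Fin n → ℝ) (F : Fin n → Dist) (C : Finset (Fin n))
    (m : unitInterval) : ℝ :=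
  ∏ i ∈ C, slope β (z i) (F i) m

theorem slopeProd_nonneg {β : ℝ} (hβ : 0 < β) (z : Fin n → ℝ) (F : Fin n → Dist)
    (C : Finset (Fin n)) (m : unitInterval) : 0 ≤ slopeProd β z F C m :=
  Finset.prod_nonneg fun _ _ => slope_nonneg hβ _ _ _

theorem slopeProd_le_one {β : ℝ} (hβ : 0 < β) (hβ1 : β ≤ 1) (z : Fin n → ℝ) (F : Fin n → Dist)
    (C : Finset (Fin n)) (m : unitInterval) : slopeProd β z F C m ≤ 1 :=
  Finset.prod_le_one (fun _ _ => slope_nonneg hβ _ _ _) fun _ _ => slope_le_one hβ hβ1 _ _ _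

theorem measurable_slopeProd (β : ℝ) (z : Fin n → ℝ) (F : Fin n → Dist) (C : Finset (Fin n)) :
    Measurable (slopeProd β z F C) :=
  Finset.measurable_fun_prod _ fun _ _ => measurable_slope _ _ _

theorem slopeProd_eq_one {β : ℝ} {z : Fin n → ℝ} {F : Fin n → Dist} {C : Finset (Fin n)}
    {m : unitInterval} (h : ∀ i ∈ C, z i ≤ (m : ℝ)) : slopeProd β z F C m = 1 :=
  Finset.prod_eq_one fun i hi => if_pos (h i hi)

/-- The value of search when the boxes in `C` are closed and the best reward found so far is
`y`. -/
def value (β : ℝ) (z : Fin n → ℝ) (F : Fin n → Dist) (C : Finset (Fin n)) (y : unitInterval) : ℝ :=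
  1 - ∫ m, if y ≤ m then slopeProd β z F C m else 0

theorem integrable_tail {P : unitInterval → ℝ} (hP : Measurable P)
    (h0 : ∀ m, 0 ≤ P m) (h1 : ∀ m, P m ≤ 1) (y : unitInterval) :
    Integrable fun m => if y ≤ m then P m else 0 :=
  integrable_of_mem_Icc (measurable_ge_ite hP y)
    (fun m => by split_ifs; exacts [h0 m, le_rfl]) (fun m => by split_ifs; exacts [h1 m, zero_le_one])

theorem le_value {β : ℝ} (hβ : 0 < β) (hβ1 : β ≤ 1) (z : Fin n → ℝ) (F : Fin n → Dist)
    (C : Finset (Fin n)) (y : unitInterval) : (y : ℝ) ≤ value β z F C y := by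
  have h := integral_mono
    (integrable_tail (measurable_slopeProd β z F C) (slopeProd_nonneg hβ z F C)
      (slopeProd_le_one hβ hβ1 z F C) y)
    (integrable_tail (P := fun _ => 1) measurable_const (by simp) (by simp) y) (fun m => by
      simp only
      split_ifs
      exacts [slopeProd_le_one hβ hβ1 z F C m, le_rfl])
  rw [integral_Ici_one] at h
  unfold value
  linarith

theorem value_eq_of_le {β : ℝ} {z : Fin n → ℝ} {F : Fin n → Dist}
    {C : Finset (Fin n)} {y : unitInterval} (h : ∀ i ∈ C, z i ≤ (y : ℝ)) :
    value β z F C y = y := by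
  have : ∀ m, (if y ≤ m then slopeProd β z F C m else 0) = if y ≤ m then (1 : ℝ) else 0 := by
    intro m
    split_ifs with hm
    · exact slopeProd_eq_one fun i hi => (h i hi).trans hm
    · rfl
  unfold value
  simp only [this]
  rw [integral_Ici_one]
  ring

theorem value_le_one {β : ℝ} (hβ : 0 < β) (z : Fin n → ℝ) (F : Fin n → Dist)
    (C : Finset (Fin n)) (y : unitInterval) : value β z F C y ≤ 1 := by
  unfold value
  have : 0 ≤ ∫ m, if y ≤ m then slopeProd β z F C m else 0 :=
    integral_nonneg fun m => by
      simp only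
      split_ifs
      exacts [slopeProd_nonneg hβ z F C m, le_rfl]
  linarith

theorem value_nonneg {β : ℝ} (hβ : 0 < β) (hβ1 : β ≤ 1) (z : Fin n → ℝ) (F : Fin n → Dist)
    (C : Finset (Fin n)) (y : unitInterval) : 0 ≤ value β z F C y :=
  y.2.1.trans (le_value hβ hβ1 z F C y)

theorem measurable_tail_integral {P : unitInterval → ℝ} (hP : Measurable P) (y : unitInterval) :
    Measurable fun x : unitInterval => ∫ m, if y ⊔ x ≤ m then P m else 0 := by
  refine StronglyMeasurable.measurable (StronglyMeasurable.integral_prod_right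
    (f := fun x m : unitInterval => if y ⊔ x ≤ m then P m else 0) ?_)
  refine (Measurable.ite ?_ (hP.comp measurable_snd) measurable_const).stronglyMeasurable
  exact measurableSet_le (measurable_const.sup measurable_fst) measurable_snd

theorem measurable_value_sup (β : ℝ) (z : Fin n → ℝ) (F : Fin n → Dist)
    (C : Finset (Fin n)) (y : unitInterval) : Measurable fun x => value β z F C (y ⊔ x) :=
  measurable_const.sub (measurable_tail_integral (measurable_slopeProd β z F C) y)

theorem integrable_value_sup {β : ℝ} (hβ : 0 < β) (hβ1 : β ≤ 1) (z : Fin n → ℝ)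
    (F : Fin n → Dist) (C : Finset (Fin n)) (y : unitInterval) (G : Dist) :
    Integrable (fun x => value β z F C (y ⊔ x)) G :=
  integrable_of_mem_Icc (measurable_value_sup β z F C y) (fun _ => value_nonneg hβ hβ1 _ _ _ _)
    fun _ => value_le_one hβ _ _ _ _

theorem integral_value_sup {β : ℝ} (hβ : 0 < β) (hβ1 : β ≤ 1) (z : Fin n → ℝ)
    (F : Fin n → Dist) (C : Finset (Fin n)) (y : unitInterval) (G : Dist) :
    ∫ x, value β z F C (y ⊔ x) ∂(G : Measure unitInterval)
      = 1 - ∫ m, if y ≤ m then cumulative G m * slopeProd β z F C m else 0 := by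
  have hi : Integrable (fun x => ∫ m, if y ⊔ x ≤ m then slopeProd β z F C m else 0)
      (G : Measure unitInterval) := by
    have := (integrable_const (1 : ℝ)).sub (integrable_value_sup hβ hβ1 z F C y G)
    refine this.congr (Filter.Eventually.of_forall fun x => ?_)
    simp [value]
  unfold value
  rw [integral_sub (integrable_const _) hi, integral_tail_max G (measurable_slopeProd β z F C)
    (slopeProd_nonneg hβ z F C) (slopeProd_le_one hβ hβ1 z F C)]
  simp

/-- Split the slope of box `i` into its excess and `β` times its distribution function. The second
summand reproduces the value after opening `i`; only the excess, weighted by the slopes of the other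
boxes, is left. -/
theorem value_eq_of_mem {β c : ℝ} (hβ : 0 < β) (hβ1 : β ≤ 1) {z : Fin n → ℝ}
    {F : Fin n → Dist} {C : Finset (Fin n)} {i : Fin n} (hi : i ∈ C) (y : unitInterval) :
    value β z F C y
        - (-c + β * ∫ x, value β z F (C.erase i) (y ⊔ x) ∂(F i : Measure unitInterval))
      = 1 - β + c
        - ∫ m, if y ≤ m then excess β (z i) (F i) m * slopeProd β z F (C.erase i) m else 0 := by
  have hmul : ∀ {f g : unitInterval → ℝ}, (∀ m, 0 ≤ f m) → (∀ m, f m ≤ 1) → (∀ m, 0 ≤ g m) →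
      (∀ m, g m ≤ 1) → Measurable f → Measurable g →
      Integrable fun m => if y ≤ m then f m * g m else 0 :=
    fun h1 h2 h3 h4 h5 h6 => integrable_tail (h5.mul h6) (fun m => mul_nonneg (h1 m) (h3 m))
      (fun m => mul_le_one₀ (h2 m) (h3 m) (h4 m)) y
  have e : ∀ m, (if y ≤ m then slopeProd β z F C m else 0)
      = (if y ≤ m then excess β (z i) (F i) m * slopeProd β z F (C.erase i) m else 0)
        + β * (if y ≤ m then cumulative (F i) m * slopeProd β z F (C.erase i) m else 0) := by
    intro m
    have : slopeProd β z F C m = slope β (z i) (F i) m * slopeProd β z F (C.erase i) m :=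
      (Finset.mul_prod_erase C _ hi).symm
    rw [this, slope_eq]
    split_ifs <;> ring
  rw [integral_value_sup hβ hβ1, value]
  simp only [e]
  rw [integral_add, integral_const_mul]
  · ring
  · exact hmul (excess_nonneg hβ hβ1 _ _) (excess_le_one hβ _ _) (slopeProd_nonneg hβ _ _ _)
      (slopeProd_le_one hβ hβ1 _ _ _) (measurable_excess _ _ _) (measurable_slopeProd _ _ _ _)
  · exact (hmul (cumulative_nonneg _) (cumulative_le_one _) (slopeProd_nonneg hβ _ _ _)
      (slopeProd_le_one hβ hβ1 _ _ _) (measurable_cumulative _)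
      (measurable_slopeProd _ _ _ _)).const_mul β

/-- `z` lists reservation prices in the unit interval of the boxes with distributions `F`. -/
structure ArePrices (β c : ℝ) (F : Fin n → Dist) (z : Fin n → ℝ) : Prop where
  pos : ∀ i, 0 < z i
  lt_one : ∀ i, z i < 1
  isReservationPrice : ∀ i, IsReservationPrice β c (F i) (z i)

/-- The weights in `value_eq_of_mem` are at most 1, so the excess recovers at most its full integral
`1 - β + c`. -/
theorem visit_le_value {β c : ℝ} (hβ : 0 < β) (hβ1 : β ≤ 1) {z : Fin n → ℝ}
    {F : Fin n → Dist} (hz : ArePrices β c F z) {C : Finset (Fin n)} {i : Fin n} (hi : i ∈ C)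
    (y : unitInterval) :
    -c + β * ∫ x, value β z F (C.erase i) (y ⊔ x) ∂(F i : Measure unitInterval)
      ≤ value β z F C y := by
  have h := value_eq_of_mem (c := c) hβ hβ1 (z := z) (F := F) hi y
  have h2 : ∫ m, (if y ≤ m then excess β (z i) (F i) m * slopeProd β z F (C.erase i) m else 0)
      ≤ ∫ m, excess β (z i) (F i) m :=
    integral_le_integral_of_nonneg (integrable_of_mem_Icc (measurable_excess _ _ _)
      (excess_nonneg hβ hβ1 _ _) (excess_le_one hβ _ _)) (excess_nonneg hβ hβ1 _ _) fun m => by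
        split_ifs
        · exact mul_le_of_le_one_right (excess_nonneg hβ hβ1 _ _ _) (slopeProd_le_one hβ hβ1 _ _ _ _)
        · exact excess_nonneg hβ hβ1 _ _ _
  rw [(hz.isReservationPrice i).integral_excess (hz.pos i).le (hz.lt_one i).le] at h2
  linarith

/-- The excess lives on `[z i, 1]`. There all other slopes equal 1 because `z i` is the highest
price, and the restriction to `[y, 1]` removes nothing because `y < z i`; so nothing is lost. -/
theorem visit_eq_value {β c : ℝ} (hβ : 0 < β) (hβ1 : β ≤ 1) {z : Fin n → ℝ}
    {F : Fin n → Dist} (hz : ArePrices β c F z) {C : Finset (Fin n)} {i : Fin n} (hi : i ∈ C)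
    {y : unitInterval} (htop : ∀ j ∈ C, z j ≤ z i) (hy : (y : ℝ) < z i) :
    -c + β * ∫ x, value β z F (C.erase i) (y ⊔ x) ∂(F i : Measure unitInterval)
      = value β z F C y := by
  have h := value_eq_of_mem (c := c) hβ hβ1 (z := z) (F := F) hi y
  have h2 : ∫ m, (if y ≤ m then excess β (z i) (F i) m * slopeProd β z F (C.erase i) m else 0)
      = ∫ m, excess β (z i) (F i) m :=
    integral_congr_ae (Filter.Eventually.of_forall fun m => by
      simp only
      by_cases hm : z i ≤ (m : ℝ)
      · rw [if_pos (show y ≤ m from hy.le.trans hm), slopeProd_eq_one, mul_one]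
        exact fun j hj => (htop j (Finset.mem_of_mem_erase hj)).trans hm
      · simp [excess, hm])
  rw [(hz.isReservationPrice i).integral_excess (hz.pos i).le (hz.lt_one i).le] at h2
  linarith

/-! ### The index policy -/

theorem mem_topClosed {β c : ℝ} {F : Fin n → Dist} {O : Finset (Fin n)} {i : Fin n} :
    i ∈ topClosed β c F O ↔ i ∉ O ∧
      ∀ j, j ∉ O → reservationPrice β c (F j) ≤ reservationPrice β c (F i) := by
  simp [topClosed]

theorem mem_bestOpened {O : Finset (Fin n)} {x : Fin n → unitInterval} {i : Fin n} :
    i ∈ bestOpened O x ↔ i ∈ O ∧ ∀ j ∈ O, x j ≤ x i := by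
  simp [bestOpened]

theorem topClosed_nonempty {β c : ℝ} {F : Fin n → Dist} {O : Finset (Fin n)} {i : Fin n}
    (hi : i ∉ O) : (topClosed β c F O).Nonempty := by
  obtain ⟨j, hj, h⟩ := Finset.exists_max_image Oᶜ (fun k => reservationPrice β c (F k))
    ⟨i, Finset.mem_compl.2 hi⟩
  exact ⟨j, mem_topClosed.2 ⟨Finset.mem_compl.1 hj, fun k hk => h k (Finset.mem_compl.2 hk)⟩⟩

theorem bestOpened_nonempty {O : Finset (Fin n)} (x : Fin n → unitInterval) (hO : O.Nonempty) :
    (bestOpened O x).Nonempty := by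
  obtain ⟨j, hj, h⟩ := Finset.exists_max_image O x hO
  exact ⟨j, mem_bestOpened.2 ⟨hj, h⟩⟩

theorem eq_sup_of_mem_bestOpened {O : Finset (Fin n)} {x : Fin n → unitInterval} {i : Fin n}
    (hi : i ∈ bestOpened O x) : x i = O.sup x :=
  le_antisymm (Finset.le_sup (mem_bestOpened.1 hi).1) (Finset.sup_le (mem_bestOpened.1 hi).2)

/-- The searcher goes on if some closed box with the highest reservation price beats the best
reward found so far. -/
def GoesOn (β c : ℝ) (F : Fin n → Dist) (O : Finset (Fin n)) (x : Fin n → unitInterval) : Prop :=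
  ∃ i ∈ topClosed β c F O, ((O.sup x : unitInterval) : ℝ) < reservationPrice β c (F i)

theorem measurable_sup_apply (O : Finset (Fin n)) :
    Measurable fun x : Fin n → unitInterval => O.sup x := by
  induction O using Finset.induction_on with
  | empty => simp
  | insert a s _ ih =>
    simp only [Finset.sup_insert]
    exact (measurable_pi_apply a).sup ih

theorem measurableSet_goesOn (β c : ℝ) (F : Fin n → Dist) (O : Finset (Fin n)) :
    MeasurableSet {x | GoesOn β c F O x} := by
  have : {x | GoesOn β c F O x} = ⋃ i ∈ topClosed β c F O,
      {x : Fin n → unitInterval | ((O.sup x : unitInterval) : ℝ) < reservationPrice β c (F i)} := by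
    ext x; simp [GoesOn]
  rw [this]
  exact Finset.measurableSet_biUnion _ fun i _ => measurableSet_lt
    (measurable_subtype_coe.comp (measurable_sup_apply O)) measurable_const

theorem measurableSet_mem_bestOpened (O : Finset (Fin n)) (i : Fin n) :
    MeasurableSet {x : Fin n → unitInterval | i ∈ bestOpened O x} := by
  have : {x : Fin n → unitInterval | i ∈ bestOpened O x} =
      {x | i ∈ O} ∩ ⋂ j ∈ O, {x : Fin n → unitInterval | x j ≤ x i} := by
    ext x; simp [mem_bestOpened]
  rw [this]
  exact (MeasurableSet.const _).inter (Finset.measurableSet_biInter _ fun j _ =>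
    measurableSet_le (measurable_pi_apply j) (measurable_pi_apply i))

theorem measurable_card_bestOpened (O : Finset (Fin n)) :
    Measurable fun x : Fin n → unitInterval => ((bestOpened O x).card : ℝ) := by
  classical
  have : (fun x : Fin n → unitInterval => ((bestOpened O x).card : ℝ))
      = fun x => ∑ i, if i ∈ bestOpened O x then (1 : ℝ) else 0 := by
    ext x; simp
  rw [this]
  exact Finset.measurable_fun_sum _ fun i _ =>
    Measurable.ite (measurableSet_mem_bestOpened O i) measurable_const measurable_const

theorem sum_ite_mem_inv_card_le_one (s : Finset (Fin n)) :
    ∑ i, (if i ∈ s then (1 : ℝ) / (s.card : ℝ) else 0) ≤ 1 := by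
  simp only [Finset.sum_ite_mem, Finset.univ_inter, Finset.sum_const, nsmul_eq_mul]
  rw [mul_one_div]
  exact div_self_le_one _

open scoped Classical in
/-- The index policy: inspect a closed box with the highest reservation price as long as this price
exceeds the best reward found so far, then take a box with the best reward. -/
def indexPolicy (β c : ℝ) (F : Fin n → Dist) : Policy n where
  visit O x i := if GoesOn β c F O x then
    (if i ∈ topClosed β c F O then 1 / ((topClosed β c F O).card : ℝ) else 0) else 0
  select O x i := if GoesOn β c F O x then 0 else
    (if i ∈ bestOpened O x then 1 / ((bestOpened O x).card : ℝ) else 0)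
  visit_nonneg O x i := by split_ifs <;> positivity
  select_nonneg O x i := by split_ifs <;> positivity
  visit_opened O x i hi := by
    rw [if_neg fun h => (mem_topClosed.1 h).1 hi, ite_self]
  select_closed O x i hi := by
    rw [if_neg fun h => hi (mem_bestOpened.1 h).1, ite_self]
  total_le_one O x := by
    split_ifs
    · simpa using sum_ite_mem_inv_card_le_one (topClosed β c F O)
    · simpa using sum_ite_mem_inv_card_le_one (bestOpened O x)
  measurable_visit O i := Measurable.ite (measurableSet_goesOn β c F O) measurable_const
    measurable_const
  measurable_select O i := Measurable.ite (measurableSet_goesOn β c F O) measurable_const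
    (Measurable.ite (measurableSet_mem_bestOpened O i)
      (measurable_const.div (measurable_card_bestOpened O)) measurable_const)

open scoped Classical in
theorem sum_visit_indexPolicy (β c : ℝ) (F : Fin n → Dist) (O : Finset (Fin n))
    (x : Fin n → unitInterval) :
    ∑ i, (indexPolicy β c F).visit O x i = if GoesOn β c F O x then 1 else 0 := by
  by_cases h : GoesOn β c F O x
  · have h2 : ((topClosed β c F O).card : ℝ) ≠ 0 := by
      obtain ⟨i, hi, -⟩ := h
      exact Nat.cast_ne_zero.2 (Finset.card_ne_zero_of_mem hi)
    simp [indexPolicy, h, h2]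
  · simp [indexPolicy, h]

theorem isFair_indexPolicy (β c : ℝ) (F : Fin n → Dist) : IsFair β c F (indexPolicy β c F) where
  visit_eq O x i hi := by
    classical
    rw [sum_visit_indexPolicy]
    by_cases h : GoesOn β c F O x <;> simp [indexPolicy, h, hi]
  select_eq O x i hi := by
    classical
    rw [sum_visit_indexPolicy]
    by_cases h : GoesOn β c F O x <;> simp [indexPolicy, h, hi]

/-- While search goes on, the outcome averages over the closed boxes with the highest reservation
price. -/
theorem outcome_indexPolicy_goesOn {β c β' c' : ℝ} {g : Fin n → unitInterval → ℝ}
    {F : Fin n → Dist} {O : Finset (Fin n)} {x : Fin n → unitInterval}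
    (h : GoesOn β c F O x) (k : ℕ) :
    outcome β' c' g F (indexPolicy β c F) (k + 1) O x =
      ∑ i ∈ topClosed β c F O, 1 / ((topClosed β c F O).card : ℝ) *
        (-c' + β' * ∫ y, outcome β' c' g F (indexPolicy β c F) k (insert i O)
          (Function.update x i y) ∂(F i : Measure unitInterval)) := by
  classical
  rw [outcome]
  simp [indexPolicy, h]

theorem outcome_indexPolicy_of_not_goesOn {β c β' c' : ℝ} {g : Fin n → unitInterval → ℝ}
    {F : Fin n → Dist} {O : Finset (Fin n)} {x : Fin n → unitInterval}
    (h : ¬ GoesOn β c F O x) (k : ℕ) :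
    outcome β' c' g F (indexPolicy β c F) k O x =
      ∑ i ∈ bestOpened O x, 1 / ((bestOpened O x).card : ℝ) * g i (x i) := by
  classical
  cases k <;> rw [outcome] <;> simp [indexPolicy, h]

theorem not_goesOn_of_compl_eq_empty {β c : ℝ} {F : Fin n → Dist} {O : Finset (Fin n)}
    {x : Fin n → unitInterval} (h : Oᶜ = ∅) : ¬ GoesOn β c F O x := by
  rintro ⟨i, hi, -⟩
  have := Finset.mem_compl.2 (mem_topClosed.1 hi).1
  simp [h] at this

theorem compl_insert_eq (i : Fin n) (O : Finset (Fin n)) : (insert i O)ᶜ = Oᶜ.erase i := by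
  ext j; simp

theorem sup_insert_update {i : Fin n} {O : Finset (Fin n)} (hi : i ∉ O)
    (x : Fin n → unitInterval) (y : unitInterval) :
    (insert i O).sup (Function.update x i y) = O.sup x ⊔ y := by
  rw [Finset.sup_insert, Function.update_self, sup_comm]
  congr 1
  exact Finset.sup_congr rfl fun j hj =>
    Function.update_of_ne (fun h => hi (by rwa [← h])) _ _

/-! ### Optimality of the index policy -/

/-- The value function dominates both stopping (`le_value`) and every inspection (`visit_le_value`).
It is nonnegative, so leaving probability for the outside option cannot help either. -/
theorem outcome_le_value {β c : ℝ} (hβ : 0 < β) (hβ1 : β ≤ 1) {z : Fin n → ℝ}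
    {F : Fin n → Dist} (hz : ArePrices β c F z) (η : Policy n) (k : ℕ) :
    ∀ (O : Finset (Fin n)) (x : Fin n → unitInterval),
      outcome β c (fun _ y => (y : ℝ)) F η k O x ≤ value β z F Oᶜ (O.sup x) := by
  have hsel : ∀ (O : Finset (Fin n)) (x : Fin n → unitInterval),
      ∑ i, η.select O x i * (x i : ℝ) ≤ (∑ i, η.select O x i) * value β z F Oᶜ (O.sup x) := by
    intro O x
    rw [Finset.sum_mul]
    refine Finset.sum_le_sum fun i _ => ?_
    by_cases hi : i ∈ O
    · exact mul_le_mul_of_nonneg_left ((show (x i : ℝ) ≤ (O.sup x : unitInterval) from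
        Finset.le_sup (f := x) hi).trans (le_value hβ hβ1 _ _ _ _)) (η.select_nonneg _ _ _)
    · simp [η.select_closed O x i hi]
  have hle : ∀ (O : Finset (Fin n)) (x : Fin n → unitInterval) (p : ℝ), p ≤ 1 →
      p * value β z F Oᶜ (O.sup x) ≤ value β z F Oᶜ (O.sup x) := fun O x p hp =>
    mul_le_of_le_one_left (value_nonneg hβ hβ1 _ _ _ _) hp
  induction k with
  | zero =>
    intro O x
    rw [outcome]
    refine (hsel O x).trans (hle _ _ _ ?_)
    have := η.total_le_one O x
    have := Finset.sum_nonneg fun i (_ : i ∈ Finset.univ) => η.visit_nonneg O x i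
    linarith
  | succ k ih =>
    intro O x
    rw [outcome]
    have hvis : ∑ i, η.visit O x i *
        (-c + β * ∫ y, outcome β c (fun _ y => (y : ℝ)) F η k (insert i O) (Function.update x i y)
          ∂(F i : Measure unitInterval))
        ≤ (∑ i, η.visit O x i) * value β z F Oᶜ (O.sup x) := by
      rw [Finset.sum_mul]
      refine Finset.sum_le_sum fun i _ => ?_
      by_cases hi : i ∈ O
      · simp [η.visit_opened O x i hi]
      · refine mul_le_mul_of_nonneg_left ?_ (η.visit_nonneg _ _ _)
        refine le_trans ?_ (visit_le_value hβ hβ1 hz (Finset.mem_compl.2 hi) (O.sup x))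
        refine add_le_add le_rfl (mul_le_mul_of_nonneg_left ?_ hβ.le)
        refine integral_le_integral_of_nonneg (integrable_value_sup hβ hβ1 _ _ _ _ _)
          (fun y => value_nonneg hβ hβ1 _ _ _ _) fun y => ?_
        have := ih (insert i O) (Function.update x i y)
        rwa [compl_insert_eq, sup_insert_update hi] at this
    refine le_trans ?_ (hle O x _ (η.total_le_one O x))
    rw [add_mul, add_comm]
    exact add_le_add hvis (hsel O x)

/-- Both actions of the index policy are tight: inspection by `visit_eq_value`, stopping by
`value_eq_of_le`. The bound on the number of closed boxes ensures that the horizon `k` never cuts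
the search short. -/
theorem outcome_indexPolicy_eq_value {β c : ℝ} (hβ : 0 < β) (hβ1 : β ≤ 1)
    {F : Fin n → Dist} (hz : ArePrices β c F fun i => reservationPrice β c (F i)) (k : ℕ) :
    ∀ (O : Finset (Fin n)) (x : Fin n → unitInterval), Oᶜ.card ≤ k →
      outcome β c (fun _ y => (y : ℝ)) F (indexPolicy β c F) k O x
        = value β (fun i => reservationPrice β c (F i)) F Oᶜ (O.sup x) := by
  have hvalue : ∀ (k : ℕ) (O : Finset (Fin n)) (x : Fin n → unitInterval), ¬ GoesOn β c F O x →
      outcome β c (fun _ y => (y : ℝ)) F (indexPolicy β c F) k O x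
        = value β (fun i => reservationPrice β c (F i)) F Oᶜ (O.sup x) := by
    intro k O x h
    rw [outcome_indexPolicy_of_not_goesOn h, value_eq_of_le]
    · rw [Finset.sum_congr rfl fun i hi => by rw [eq_sup_of_mem_bestOpened hi]]
      -- With no opened box the sum is empty, and the empty supremum is 0, the outside option.
      rcases O.eq_empty_or_nonempty with rfl | hO
      · simp [bestOpened]
      · have : ((bestOpened O x).card : ℝ) ≠ 0 :=
          Nat.cast_ne_zero.2 (bestOpened_nonempty x hO).card_pos.ne'
        simp only [Finset.sum_const, nsmul_eq_mul]
        field_simp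
    · intro i hi
      obtain ⟨j, hj⟩ := topClosed_nonempty (β := β) (c := c) (F := F) (Finset.mem_compl.1 hi)
      have h2 : ¬ ((O.sup x : unitInterval) : ℝ) < reservationPrice β c (F j) :=
        fun h3 => h ⟨j, hj, h3⟩
      exact ((mem_topClosed.1 hj).2 i (Finset.mem_compl.1 hi)).trans (not_lt.1 h2)
  induction k with
  | zero =>
    intro O x hk
    exact hvalue 0 O x (not_goesOn_of_compl_eq_empty (Finset.card_eq_zero.1 (Nat.le_zero.1 hk)))
  | succ k ih =>
    intro O x hk
    by_cases h : GoesOn β c F O x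
    · rw [outcome_indexPolicy_goesOn h]
      obtain ⟨i, hi, hlt⟩ := h
      have hc : ((topClosed β c F O).card : ℝ) ≠ 0 :=
        Nat.cast_ne_zero.2 (Finset.card_ne_zero_of_mem hi)
      have : ∀ j ∈ topClosed β c F O, -c + β * ∫ y, outcome β c (fun _ y => (y : ℝ)) F
          (indexPolicy β c F) k (insert j O) (Function.update x j y) ∂(F j : Measure unitInterval)
          = value β (fun i => reservationPrice β c (F i)) F Oᶜ (O.sup x) := by
        intro j hj
        have hjO := (mem_topClosed.1 hj).1
        rw [← visit_eq_value hβ hβ1 hz (Finset.mem_compl.2 hjO)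
          (fun l hl => (mem_topClosed.1 hj).2 l (Finset.mem_compl.1 hl))
          (hlt.trans_le ((mem_topClosed.1 hj).2 i (mem_topClosed.1 hi).1))]
        congr 3
        ext y
        rw [ih, compl_insert_eq, sup_insert_update hjO]
        rw [compl_insert_eq, Finset.card_erase_of_mem (Finset.mem_compl.2 hjO)]
        omega
      rw [Finset.sum_congr rfl fun j hj => by rw [this j hj]]
      simp only [Finset.sum_const, nsmul_eq_mul]
      field_simp
    · exact hvalue _ O x h

theorem searchUtility_indexPolicy {β c : ℝ} (hβ : 0 < β) (hβ1 : β ≤ 1)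
    {F : Fin n → Dist} (hz : ArePrices β c F fun i => reservationPrice β c (F i)) :
    searchUtility β c F (indexPolicy β c F)
      = value β (fun i => reservationPrice β c (F i)) F Finset.univ 0 := by
  rw [searchUtility, outcome_indexPolicy_eq_value hβ hβ1 hz _ _ _ (by simp)]
  simp
  rfl

theorem searchUtility_le_indexPolicy {β c : ℝ} (hβ : 0 < β) (hβ1 : β ≤ 1)
    {F : Fin n → Dist} (hz : ArePrices β c F fun i => reservationPrice β c (F i)) (η : Policy n) :
    searchUtility β c F η ≤ searchUtility β c F (indexPolicy β c F) := by
  rw [searchUtility, searchUtility, outcome_indexPolicy_eq_value hβ hβ1 hz _ _ _ (by simp)]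
  exact outcome_le_value hβ hβ1 hz η n ∅ 0

theorem arePrices_reservationPrice {β c μ : ℝ} (hβ : 0 < β) (hβ1 : β ≤ 1) (hc : 0 ≤ c)
    (hβc : β < 1 ∨ 0 < c) (hcμ : c < β * μ) {F : Fin n → Dist} (hF : ∀ i, F i ∈ feasible μ) :
    ArePrices β c F fun i => reservationPrice β c (F i) := by
  have h := fun i => isReservationPrice_reservationPrice (hF i) hβ1 hc hcμ
  exact ⟨fun i => (h i).pos (hF i) hβ hcμ, fun i => (h i).lt_one hβ1 hc hβc, h⟩

/-! ### Full information -/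

theorem integral_prior (μ : unitInterval) (f : unitInterval → ℝ) :
    ∫ x, f x ∂(prior μ : Measure unitInterval) = μ * f 1 + (1 - μ) * f 0 := by
  have h1 : (0 : ℝ) ≤ 1 - μ := sub_nonneg.2 μ.2.2
  change ∫ x, f x ∂(ENNReal.ofReal (μ : ℝ) • Measure.dirac 1
    + ENNReal.ofReal (1 - (μ : ℝ)) • Measure.dirac 0) = _
  rw [integral_add_measure, integral_smul_measure, integral_smul_measure, integral_dirac,
    integral_dirac, ENNReal.toReal_ofReal μ.2.1, ENNReal.toReal_ofReal h1]
  · rfl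
  all_goals exact (integrable_dirac (by simp)).smul_measure ENNReal.ofReal_ne_top

theorem prior_mem_feasible (μ : unitInterval) : prior μ ∈ feasible (μ : ℝ) := by
  simp [feasible, integral_prior]

theorem cumulative_prior {μ m : unitInterval} (hm : m < 1) :
    cumulative (prior μ) m = 1 - μ := by
  rw [← integral_le_indicator, integral_prior, if_neg (not_le.2 hm), if_pos (show (0 : unitInterval) ≤ m from m.2.1)]
  ring

theorem IsReservationPrice.prior_eq {β c z : ℝ} {μ : unitInterval} (h0 : 0 ≤ z) (h1 : z ≤ 1)
    (hz : IsReservationPrice β c (prior μ) z) : z = -c + β * (μ + (1 - μ) * z) := by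
  unfold IsReservationPrice at hz
  rw [integral_prior] at hz
  simpa [h0, h1] using hz

/-- The chord `z + (1 - z) * x` exceeds `max z x` strictly for `0 < x < 1`, so equality of the
integrals forces all mass onto 0 and 1, and the mean then fixes the weights. -/
theorem eq_prior_of_integral_eq {μ : unitInterval} {G : Dist} (hG : G ∈ feasible (μ : ℝ)) {z : ℝ}
    (h0 : 0 < z) (h1 : z < 1)
    (h : ∫ x, max z (x : ℝ) ∂(G : Measure unitInterval) = μ + (1 - μ) * z) : G = prior μ := by
  have hmean : ∫ x : unitInterval, (x : ℝ) ∂(G : Measure unitInterval) = μ := hG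
  have hi : Integrable (fun x : unitInterval => z + (1 - z) * (x : ℝ)) (G : Measure unitInterval) :=
    (integrable_const _).add ((integrable_coe G).const_mul _)
  have hi2 : Integrable (fun x : unitInterval => z + (1 - z) * (x : ℝ) - max z (x : ℝ))
      (G : Measure unitInterval) := hi.sub (integrable_max G z)
  have hint : ∫ x : unitInterval, (z + (1 - z) * (x : ℝ) - max z (x : ℝ))
      ∂(G : Measure unitInterval) = 0 := by
    rw [integral_sub hi (integrable_max G z), h,
      integral_add (integrable_const _) ((integrable_coe G).const_mul _), integral_const_mul, hmean]
    simp
    ring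
  have hpos : ∀ x : unitInterval, 0 ≤ z + (1 - z) * (x : ℝ) - max z (x : ℝ) := by
    intro x
    rw [sub_nonneg]
    apply max_le <;> nlinarith [x.2.1, x.2.2]
  have hae := (integral_eq_zero_iff_of_nonneg hpos hi2).1 hint
  have hsupp : ∀ᵐ x ∂(G : Measure unitInterval), x = 0 ∨ x = 1 := by
    filter_upwards [hae] with x hx
    simp only [Pi.zero_apply] at hx
    by_contra! hne
    have hx0 : 0 < (x : ℝ) := unitInterval.pos_iff_ne_zero.2 hne.1
    have hx1 : (x : ℝ) < 1 := unitInterval.lt_one_iff_ne_one.2 hne.2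
    rcases max_cases z (x : ℝ) with h | h <;> rw [h.1] at hx <;> nlinarith
  apply Subtype.ext
  refine Measure.ext fun s hs => ?_
  -- On the two-point support every indicator is affine in `x`, so its integral depends on the mean
  -- only.
  have key : ∀ x : unitInterval, x = 0 ∨ x = 1 → s.indicator (1 : unitInterval → ℝ) x
      = x * s.indicator (1 : unitInterval → ℝ) 1
        + (1 - x) * s.indicator (1 : unitInterval → ℝ) 0 := by
    rintro x (rfl | rfl) <;> simp
  have e1 : (G : Measure unitInterval).real s = (prior μ : Measure unitInterval).real s := by
    rw [← integral_indicator_one hs, ← integral_indicator_one hs, integral_prior,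
      integral_congr_ae (hsupp.mono key), integral_add, integral_mul_const, integral_mul_const,
      integral_sub (integrable_const _) (integrable_coe G), hmean]
    · simp
    · exact (integrable_coe G).mul_const _
    · exact ((integrable_const _).sub (integrable_coe G)).mul_const _
  change (G : Measure unitInterval) s = (prior μ : Measure unitInterval) s
  exact (measureReal_eq_measureReal_iff (measure_ne_top _ _) (measure_ne_top _ _)).1 e1

/-- Any other distribution with the same mean has a lower reservation price than the prior. -/
theorem IsReservationPrice.lt_prior {β c z z' : ℝ} {μ : unitInterval} (hμ : 0 < (μ : ℝ))
    (hβ : 0 < β) (hβ1 : β ≤ 1) {G : Dist} (hG : G ∈ feasible (μ : ℝ)) (hne : G ≠ prior μ)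
    (hz : IsReservationPrice β c G z) (hz0 : 0 < z) (hz1 : z < 1)
    (hz' : IsReservationPrice β c (prior μ) z') (hz0' : 0 < z') (hz1' : z' < 1) : z < z' := by
  have hmean : ∫ x : unitInterval, (x : ℝ) ∂(G : Measure unitInterval) = μ := hG
  have h1 := hz'.prior_eq hz0'.le hz1'.le
  have hi : Integrable (fun x : unitInterval => z + (1 - z) * (x : ℝ)) (G : Measure unitInterval) :=
    (integrable_const _).add ((integrable_coe G).const_mul _)
  have hle : ∫ x, max z (x : ℝ) ∂(G : Measure unitInterval) ≤ μ + (1 - μ) * z := by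
    have : ∫ x : unitInterval, (z + (1 - z) * (x : ℝ)) ∂(G : Measure unitInterval)
        = μ + (1 - μ) * z := by
      rw [integral_add (integrable_const _) ((integrable_coe G).const_mul _), integral_const_mul,
        hmean]
      simp
      ring
    rw [← this]
    refine integral_mono (integrable_max G z) hi fun x => ?_
    apply max_le <;> nlinarith [x.2.1, x.2.2]
  have hlt := lt_of_le_of_ne hle fun h => hne (eq_prior_of_integral_eq hG hz0 hz1 h)
  have h2 := mul_lt_mul_of_pos_left hlt hβ
  unfold IsReservationPrice at hz
  -- `z'` is the fixed point of `t ↦ -c + β * (μ + (1 - μ) * t)`, a map of slope below 1 that takes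
  -- `z` to a larger number.
  have h3 : (z' - z) * (1 - β * (1 - μ)) > 0 := by linarith
  have h4 : 0 < 1 - β * (1 - μ) := by nlinarith [μ.2.2]
  nlinarith [(pos_iff_pos_of_mul_pos h3).2 h4]

/-- The product of the slopes is at most 1 above `z` and at most `(1 - μ) ^ n` below it. -/
theorem le_value_prior {β : ℝ} (hβ : 0 < β) (hβ1 : β ≤ 1) {μ : unitInterval} {z : ℝ}
    (h0 : 0 < z) (h1 : z < 1) :
    z * (1 - (1 - μ) ^ n) ≤ value β (fun _ => z) (fun _ : Fin n => prior μ) Finset.univ 0 := by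
  have hμ : (0 : ℝ) ≤ 1 - μ := sub_nonneg.2 μ.2.2
  set y : unitInterval := ⟨z, h0.le, h1.le⟩
  have hle : ∀ m : unitInterval,
      (if (0 : unitInterval) ≤ m then
        slopeProd β (fun _ => z) (fun _ : Fin n => prior μ) Finset.univ m else 0)
      ≤ (1 - (1 - (μ : ℝ)) ^ n) * (if y ≤ m then 1 else 0) + (1 - (μ : ℝ)) ^ n := by
    intro m
    rw [if_pos (show (0 : unitInterval) ≤ m from m.2.1)]
    by_cases hm : y ≤ m
    · rw [if_pos hm]
      have := slopeProd_le_one hβ hβ1 (fun _ => z) (fun _ : Fin n => prior μ) Finset.univ m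
      linarith
    · have hm1 : m < 1 := (not_le.1 hm).trans (show z < 1 from h1)
      rw [if_neg hm, mul_zero, zero_add, slopeProd]
      simp only [slope, if_neg (show ¬ z ≤ (m : ℝ) from hm), cumulative_prior hm1,
        Finset.prod_const, Finset.card_univ, Fintype.card_fin]
      exact pow_le_pow_left₀ (mul_nonneg hβ.le hμ) (mul_le_of_le_one_left hμ hβ1) n
  have h := integral_mono (integrable_tail (measurable_slopeProd β (fun _ => z)
    (fun _ : Fin n => prior μ) Finset.univ) (slopeProd_nonneg hβ _ _ _)
    (slopeProd_le_one hβ hβ1 _ _ _) 0) (((integrable_tail (P := fun _ => (1 : ℝ)) measurable_const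
    (by simp) (by simp) y).const_mul _).add (integrable_const _)) hle
  simp only [Pi.add_apply] at h
  rw [integral_add ((integrable_tail (P := fun _ => (1 : ℝ)) measurable_const
    (by simp) (by simp) y).const_mul _) (integrable_const _), integral_const_mul,
    integral_Ici_one] at h
  simp at h
  rw [value]
  have : (y : ℝ) = z := rfl
  rw [this] at h
  simp at h ⊢
  linarith

/-! ### The probability of being taken -/

theorem sup_zero (O : Finset (Fin n)) : O.sup (0 : Fin n → unitInterval) = 0 :=
  le_antisymm (Finset.sup_le fun _ _ => le_rfl) bot_le

/-- A reward of 1 exceeds every reservation price, so search stops at once. Hence, as long as fully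
informative boxes are opened, only the state in which all opened boxes show 0 has to be followed. -/
theorem outcome_indexPolicy_success {β c β' c' : ℝ} {g : Fin n → unitInterval → ℝ}
    {F : Fin n → Dist} (hF : ∀ i, reservationPrice β c (F i) < 1) {O : Finset (Fin n)} {j : Fin n}
    (hj : j ∉ O) (k : ℕ) :
    outcome β' c' g F (indexPolicy β c F) k (insert j O) (Function.update 0 j 1) = g j 1 := by
  have hsup : (insert j O).sup (Function.update (0 : Fin n → unitInterval) j 1) = 1 := by
    rw [sup_insert_update hj, sup_zero]
    exact sup_eq_right.2 zero_le_one
  have hbest : bestOpened (insert j O) (Function.update (0 : Fin n → unitInterval) j 1) = {j} := by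
    ext i
    rw [mem_bestOpened, Finset.mem_singleton]
    constructor
    · rintro ⟨-, h⟩
      by_contra hne
      have := h j (Finset.mem_insert_self j O)
      rw [Function.update_self, Function.update_of_ne hne] at this
      exact absurd this (not_le.2 zero_lt_one)
    · rintro rfl
      refine ⟨Finset.mem_insert_self _ _, fun k _ => ?_⟩
      rw [Function.update_self]
      exact le_top
  rw [outcome_indexPolicy_of_not_goesOn, hbest]
  · simp
  · rintro ⟨i, -, h⟩
    rw [hsup] at h
    exact absurd h (not_lt.2 (hF i).le)

theorem outcome_indexPolicy_prior_step {β c : ℝ} {μ : unitInterval}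
    {g : Fin n → unitInterval → ℝ} {F : Fin n → Dist} (hF : ∀ i, reservationPrice β c (F i) < 1)
    {O : Finset (Fin n)} {j : Fin n} (hj : j ∉ O) (hFj : F j = prior μ) (k : ℕ) :
    ∫ y, outcome 1 0 g F (indexPolicy β c F) k (insert j O)
        (Function.update 0 j y) ∂(F j : Measure unitInterval)
      = μ * g j 1 + (1 - μ) * outcome 1 0 g F (indexPolicy β c F) k (insert j O) 0 := by
  rw [hFj, integral_prior, outcome_indexPolicy_success hF hj]
  congr 4
  exact Function.update_eq_self j (0 : Fin n → unitInterval)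

theorem goesOn_zero {β c : ℝ} {F : Fin n → Dist} (hF : ∀ i, 0 < reservationPrice β c (F i))
    {O : Finset (Fin n)} {i : Fin n} (hi : i ∉ O) : GoesOn β c F O 0 := by
  obtain ⟨j, hj⟩ := topClosed_nonempty (β := β) (c := c) (F := F) hi
  exact ⟨j, hj, by rw [sup_zero]; exact hF j⟩

/-- With probability `(1 - μ) ^ Oᶜ.card` all remaining boxes fail and the tie at 0 is broken among
all `n`; otherwise a success occurs, and by symmetry each closed box is equally likely to be the one
that is taken. -/
theorem outcome_indexPolicy_prior {β c : ℝ} {μ : unitInterval}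
    (h0 : 0 < reservationPrice β c (prior μ)) (h1 : reservationPrice β c (prior μ) < 1)
    (i : Fin n) (k : ℕ) :
    ∀ O : Finset (Fin n), Oᶜ.card ≤ k →
      outcome 1 0 (fun j _ => if j = i then 1 else 0) (fun _ : Fin n => prior μ)
          (indexPolicy β c fun _ => prior μ) k O 0
        = (1 - (μ : ℝ)) ^ Oᶜ.card / n
          + if i ∈ O then 0 else (1 - (1 - (μ : ℝ)) ^ Oᶜ.card) / Oᶜ.card := by
  have hfull : ∀ (k : ℕ) (O : Finset (Fin n)), Oᶜ = ∅ →
      outcome 1 0 (fun j _ => if j = i then 1 else 0) (fun _ : Fin n => prior μ)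
          (indexPolicy β c fun _ => prior μ) k O 0
        = (1 - (μ : ℝ)) ^ Oᶜ.card / n
          + if i ∈ O then 0 else (1 - (1 - (μ : ℝ)) ^ Oᶜ.card) / Oᶜ.card := by
    intro k O hO
    have : O = Finset.univ := by rwa [← Finset.compl_eq_empty_iff]
    subst this
    rw [outcome_indexPolicy_of_not_goesOn (not_goesOn_of_compl_eq_empty hO)]
    have : bestOpened (Finset.univ : Finset (Fin n)) (0 : Fin n → unitInterval) = Finset.univ := by
      ext j; simp [mem_bestOpened]
    rw [this]
    simp
  induction k with
  | zero => exact fun O hO => hfull 0 O (Finset.card_eq_zero.1 (Nat.le_zero.1 hO))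
  | succ k ih =>
    intro O hO
    by_cases he : Oᶜ = ∅
    · exact hfull _ O he
    obtain ⟨j, hj⟩ := Finset.nonempty_iff_ne_empty.2 he
    rw [outcome_indexPolicy_goesOn (goesOn_zero (fun _ => h0) (Finset.mem_compl.1 hj))]
    have htop : topClosed β c (fun _ : Fin n => prior μ) O = Oᶜ := by
      ext l; simp [mem_topClosed]
    rw [htop]
    obtain ⟨m, hm⟩ : ∃ m, Oᶜ.card = m + 1 :=
      Nat.exists_eq_succ_of_ne_zero (Finset.card_ne_zero_of_mem hj)
    -- For `m = 0` the quotient is `0 / 0 = 0`, as it should be when no further box is closed.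
    have hstep : ∀ l ∈ Oᶜ, ∫ y, outcome 1 0 (fun j _ => if j = i then (1 : ℝ) else 0)
          (fun _ : Fin n => prior μ) (indexPolicy β c fun _ => prior μ) k (insert l O)
          (Function.update 0 l y) ∂(prior μ : Measure unitInterval)
        = (1 - (μ : ℝ)) ^ (m + 1) / n + (if i ∈ O then 0 else (1 - μ) * ((1 - (1 - (μ : ℝ)) ^ m) / m))
          + if l = i then μ - (1 - μ) * ((1 - (1 - (μ : ℝ)) ^ m) / m) else 0 := by
      intro l hl
      have hlO := Finset.mem_compl.1 hl
      have hcard : (insert l O)ᶜ.card = m := by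
        rw [compl_insert_eq, Finset.card_erase_of_mem hl]; omega
      rw [outcome_indexPolicy_prior_step (F := fun _ : Fin n => prior μ) (fun _ => h1) hlO rfl,
        ih _ (by omega), hcard]
      by_cases hli : l = i
      · subst hli
        simp [hlO]
        ring
      · have : i ∈ insert l O ↔ i ∈ O := by simp [Ne.symm hli]
        simp only [this, if_neg hli]
        split_ifs <;> ring
    rw [Finset.sum_congr rfl fun l hl => by rw [hstep l hl]]
    rw [← Finset.mul_sum]
    simp only [neg_zero, zero_add, one_mul, Finset.sum_add_distrib, Finset.sum_const, nsmul_eq_mul,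
      Finset.sum_ite_eq', Finset.mem_compl, hm]
    have hm0 : ((m + 1 : ℕ) : ℝ) ≠ 0 := by positivity
    by_cases hi : i ∈ O
    · simp only [hi, not_true, if_true, if_false, add_zero]
      field_simp
      rw [add_zero]
    · simp only [hi, not_false_iff, if_true, if_false]
      rcases Nat.eq_zero_or_pos m with rfl | hmp
      · simp
      · have hm1 : (m : ℝ) ≠ 0 := by positivity
        rw [div_mul_eq_mul_div, one_mul, div_eq_iff hm0, add_mul, div_mul_cancel₀ _ hm0]
        push_cast
        field_simp
        ring

theorem selectionProb_prior {β c : ℝ} {μ : unitInterval}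
    (h0 : 0 < reservationPrice β c (prior μ)) (h1 : reservationPrice β c (prior μ) < 1)
    (i : Fin n) :
    selectionProb (fun _ => prior μ) (indexPolicy β c fun _ => prior μ) i = 1 / n := by
  rw [selectionProb, outcome_indexPolicy_prior h0 h1 i n ∅ (by simp)]
  simp
  ring

theorem outcome_le_one {g : Fin n → unitInterval → ℝ} (hg : ∀ i y, g i y ≤ 1) (F : Fin n → Dist)
    (η : Policy n) (k : ℕ) : ∀ (O : Finset (Fin n)) (x : Fin n → unitInterval),
      outcome 1 0 g F η k O x ≤ 1 := by
  have hsel : ∀ (O : Finset (Fin n)) (x : Fin n → unitInterval),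
      ∑ i, η.select O x i * g i (x i) ≤ ∑ i, η.select O x i := fun O x =>
    Finset.sum_le_sum fun i _ => mul_le_of_le_one_right (η.select_nonneg _ _ _) (hg _ _)
  induction k with
  | zero =>
    intro O x
    rw [outcome]
    have := η.total_le_one O x
    have := Finset.sum_nonneg fun i (_ : i ∈ Finset.univ) => η.visit_nonneg O x i
    linarith [hsel O x]
  | succ k ih =>
    intro O x
    rw [outcome]
    have hvis : ∑ i, η.visit O x i *
        (-0 + 1 * ∫ y, outcome 1 0 g F η k (insert i O) (Function.update x i y)
          ∂(F i : Measure unitInterval)) ≤ ∑ i, η.visit O x i := by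
      refine Finset.sum_le_sum fun i _ => mul_le_of_le_one_right (η.visit_nonneg _ _ _) ?_
      rw [neg_zero, zero_add, one_mul]
      refine (integral_le_integral_of_nonneg (g := fun _ => 1) (integrable_const _) (by simp)
        fun y => ih _ _).trans (by simp)
    linarith [hsel O x, η.total_le_one O x]

/-- The strictly lower price puts box `i` last. Each other closed box must first show 0, which costs
a factor `1 - μ`; once only `i` is left, the bound is 1. -/
theorem outcome_indexPolicy_deviation {β c : ℝ} {μ : unitInterval} {F : Fin n → Dist} {i : Fin n}
    (hF : ∀ j, j ≠ i → F j = prior μ) (h0 : ∀ j, 0 < reservationPrice β c (F j))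
    (h1 : ∀ j, reservationPrice β c (F j) < 1)
    (hlt : reservationPrice β c (F i) < reservationPrice β c (prior μ)) (k : ℕ) :
    ∀ O : Finset (Fin n), i ∉ O →
      outcome 1 0 (fun j _ => if j = i then 1 else 0) F (indexPolicy β c F) k O 0
        ≤ (1 - (μ : ℝ)) ^ (Oᶜ.card - 1) := by
  have hμ : (0 : ℝ) ≤ 1 - μ := sub_nonneg.2 μ.2.2
  induction k with
  | zero =>
    intro O hi
    rw [outcome]
    refine le_trans (le_of_eq (Finset.sum_eq_zero fun j _ => ?_)) (pow_nonneg hμ _)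
    by_cases hj : j = i
    · subst hj; rw [(indexPolicy β c F).select_closed _ _ _ hi, zero_mul]
    · simp [hj]
  | succ k ih =>
    intro O hi
    by_cases hO : ∃ j, j ∉ O ∧ j ≠ i
    · obtain ⟨j, hj, hji⟩ := hO
      rw [outcome_indexPolicy_goesOn (goesOn_zero h0 hi)]
      have htop : ∀ l ∈ topClosed β c F O, l ∉ O ∧ l ≠ i := by
        intro l hl
        refine ⟨(mem_topClosed.1 hl).1, ?_⟩
        rintro rfl
        have := (mem_topClosed.1 hl).2 j hj
        rw [hF j hji] at this
        exact absurd hlt (not_lt.2 this)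
      have hc : ((topClosed β c F O).card : ℝ) ≠ 0 :=
        Nat.cast_ne_zero.2 (topClosed_nonempty hi).card_pos.ne'
      refine (Finset.sum_le_sum (g := fun _ => 1 / ((topClosed β c F O).card : ℝ)
        * (1 - (μ : ℝ)) ^ (Oᶜ.card - 1)) fun l hl => ?_).trans (le_of_eq ?_)
      · refine mul_le_mul_of_nonneg_left ?_ (by positivity)
        obtain ⟨hlO, hli⟩ := htop l hl
        rw [outcome_indexPolicy_prior_step h1 hlO (hF l hli), if_neg hli]
        have h2 := ih (insert l O) (by simp [hi, Ne.symm hli])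
        have hcard : Oᶜ.card - 1 = ((insert l O)ᶜ.card - 1) + 1 := by
          rw [compl_insert_eq, Finset.card_erase_of_mem (Finset.mem_compl.2 hlO)]
          have : 1 < Oᶜ.card := Finset.one_lt_card.2
            ⟨l, Finset.mem_compl.2 hlO, i, Finset.mem_compl.2 hi, hli⟩
          omega
        rw [hcard, pow_succ']
        have := mul_le_mul_of_nonneg_left h2 hμ
        linarith
      · simp only [Finset.sum_const, nsmul_eq_mul]
        field_simp
    · push Not at hO
      have : Oᶜ = {i} := by
        ext j
        rw [Finset.mem_compl, Finset.mem_singleton]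
        exact ⟨hO j, fun h => h ▸ hi⟩
      rw [this]
      simp only [Finset.card_singleton, Nat.sub_self, pow_zero]
      exact outcome_le_one (fun j _ => by split_ifs <;> simp) _ _ _ _ _

theorem exists_isFSPE {μ : unitInterval} (hμ0 : 0 < (μ : ℝ))
    (hμn : (1 - (μ : ℝ)) ^ (n - 1) ≤ 1 / n) {β c : ℝ} (hβ : 0 < β) (hβ1 : β ≤ 1) (hc : 0 ≤ c)
    (hβc : β < 1 ∨ 0 < c) (hcμ : c < β * μ) :
    IsFSPE (μ : ℝ) β c (fun F => indexPolicy β c F) (fun _ : Fin n => prior μ) where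
  feasible_profile _ := prior_mem_feasible μ
  optimal _ hH η' :=
    searchUtility_le_indexPolicy hβ hβ1 (arePrices_reservationPrice hβ hβ1 hc hβc hcμ hH) η'
  fair _ _ := isFair_indexPolicy _ _ _
  no_deviation i G hG := by
    have hp := arePrices_reservationPrice hβ hβ1 hc hβc hcμ
      (F := fun _ : Fin n => prior μ) fun _ => prior_mem_feasible μ
    by_cases hGp : G = prior μ
    · subst hGp
      have : Function.update (fun _ : Fin n => prior μ) i (prior μ) = fun _ => prior μ :=
        Function.update_eq_self i _
      rw [this]
    · have hH : ∀ j, Function.update (fun _ : Fin n => prior μ) i G j ∈ feasible (μ : ℝ) := by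
        intro j
        by_cases hj : j = i
        · subst hj; rwa [Function.update_self]
        · rw [Function.update_of_ne hj]; exact prior_mem_feasible μ
      have hd := arePrices_reservationPrice hβ hβ1 hc hβc hcμ hH
      -- The deviator gets at most `(1 - μ) ^ (n - 1)`, which the assumption on `μ` bounds by the
      -- payoff `1 / n` of conforming.
      rw [selectionProb_prior (hp.pos i) (hp.lt_one i)]
      refine le_trans (le_of_le_of_eq (outcome_indexPolicy_deviation (μ := μ) (i := i)
        (fun j hj => Function.update_of_ne hj _ _) hd.pos hd.lt_one ?_ n ∅ (by simp)) ?_) hμn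
      · have e1 := hd.isReservationPrice i
        have e2 := hd.pos i
        have e3 := hd.lt_one i
        simp only [Function.update_self] at e1 e2 e3 ⊢
        exact e1.lt_prior hμ0 hβ hβ1 hG hGp e2 e3 (hp.isReservationPrice i) (hp.pos i) (hp.lt_one i)
      · simp

/-- Full information yields almost the first best if search frictions are small. -/
theorem le_searchUtility_of_isFSPE {μ : unitInterval} {β c : ℝ}
    (hβ : 0 < β) (hβ1 : β ≤ 1) (hc : 0 ≤ c)
    (hβc : β < 1 ∨ 0 < c) (hcμ : c < β * μ) {η : (Fin n → Dist) → Policy n}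
    (hη : IsFSPE (μ : ℝ) β c η (fun _ : Fin n => prior μ)) (hn : n ≠ 0) :
    ∃ z : ℝ, 0 ≤ z ∧ z ≤ 1 ∧ (1 - z) * μ ≤ 1 - β + c ∧
      z * (1 - (1 - (μ : ℝ)) ^ n) ≤
        searchUtility β c (fun _ : Fin n => prior μ) (η fun _ : Fin n => prior μ) := by
  have hp := arePrices_reservationPrice hβ hβ1 hc hβc hcμ
      (F := fun _ : Fin n => prior μ) fun _ => prior_mem_feasible μ
  let i : Fin n := ⟨0, Nat.pos_of_ne_zero hn⟩
  have h0 := hp.pos i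
  have h1 := hp.lt_one i
  refine ⟨reservationPrice β c (prior μ), h0.le, h1.le, ?_, ?_⟩
  -- The price equation reads `(1 - z) * (1 - β * (1 - μ)) = 1 - β + c`, and `1 - β * (1 - μ)` is at
  -- least `μ`.
  · have := (hp.isReservationPrice i).prior_eq h0.le h1.le
    nlinarith [mul_nonneg (mul_nonneg (sub_nonneg.2 h1.le) (sub_nonneg.2 hβ1))
      (sub_nonneg.2 μ.2.2)]
  · refine le_trans ?_ (hη.optimal _ (fun _ => prior_mem_feasible μ) 
      (indexPolicy β c fun _ => prior μ))
    rw [searchUtility_indexPolicy hβ hβ1 hp]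
    exact le_value_prior hβ hβ1 h0 h1

/-! ### The probability of being taken without frictions -/

theorem winShare_nonneg (i : Fin n) (x : Fin n → unitInterval) : 0 ≤ winShare i x := by
  unfold winShare
  split_ifs <;> positivity

theorem winShare_le_one (i : Fin n) (x : Fin n → unitInterval) : winShare i x ≤ 1 := by
  classical
  unfold winShare
  split_ifs with h
  · have : 1 ≤ (Finset.univ.filter fun k : Fin n => ∀ j, x j ≤ x k).card :=
      Finset.card_pos.2 ⟨i, by simpa using h⟩
    rw [div_le_one (by positivity)]
    exact_mod_cast this
  · exact zero_le_one

theorem winShare_eq (i : Fin n) (x : Fin n → unitInterval) :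
    winShare i x = if i ∈ bestOpened Finset.univ x
      then 1 / ((bestOpened Finset.univ x).card : ℝ) else 0 := by
  classical
  have h : (bestOpened Finset.univ x) = Finset.univ.filter fun k : Fin n => ∀ j, x j ≤ x k := by
    ext k; simp [mem_bestOpened]
  unfold winShare
  rw [h]
  simp only [Finset.mem_filter, Finset.mem_univ, true_and]

theorem measurable_winShare (i : Fin n) :
    Measurable fun x : Fin n → unitInterval => winShare i x := by
  simp only [winShare_eq]
  exact Measurable.ite (measurableSet_mem_bestOpened _ i)
    (measurable_const.div (measurable_card_bestOpened _)) measurable_const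

theorem sum_winShare (hn : n ≠ 0) (x : Fin n → unitInterval) : ∑ i, winShare i x = 1 := by
  have : (Finset.univ : Finset (Fin n)).Nonempty := ⟨⟨0, Nat.pos_of_ne_zero hn⟩, Finset.mem_univ _⟩
  have h := (bestOpened_nonempty x this).card_pos.ne'
  simp only [winShare_eq, Finset.sum_ite_mem, Finset.univ_inter, Finset.sum_const, nsmul_eq_mul]
  field_simp

/-! ### Unilateral deviations as redrawing one coordinate -/

instance isProbabilityMeasure_jointLaw (F : Fin n → Dist) : IsProbabilityMeasure (jointLaw F) := by
  unfold jointLaw; infer_instance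

theorem sum_frictionlessPayoff (hn : n ≠ 0) (F : Fin n → Dist) :
    ∑ i, frictionlessPayoff F i = 1 := by
  unfold frictionlessPayoff
  rw [← integral_finsetSum]
  · simp [sum_winShare hn]
  · exact fun i _ => integrable_of_mem_Icc (measurable_winShare i) (winShare_nonneg i)
      (winShare_le_one i)

theorem measurable_update_prod (i : Fin n) :
    Measurable fun p : (Fin n → unitInterval) × unitInterval => Function.update p.1 i p.2 := by
  rw [measurable_pi_iff]
  intro j
  by_cases hj : j = i
  · subst hj; simpa using measurable_snd
  · simp only [Function.update_of_ne hj]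
    exact (measurable_pi_apply j).comp measurable_fst

/-- Redrawing one coordinate of a product measure from another distribution. -/
theorem jointLaw_update (F : Fin n → Dist) (i : Fin n) (G : Dist) :
    jointLaw (Function.update F i G) = ((jointLaw F).prod (G : Measure unitInterval)).map
      fun p => Function.update p.1 i p.2 := by
  unfold jointLaw
  refine Measure.pi_eq fun s hs => ?_
  rw [Measure.map_apply (measurable_update_prod i) (MeasurableSet.univ_pi hs)]
  -- The old coordinate `i` is discarded, so it is unconstrained and contributes a factor 1.
  have : (fun p : (Fin n → unitInterval) × unitInterval => Function.update p.1 i p.2) ⁻¹'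
      Set.univ.pi s = (Set.univ.pi (Function.update s i Set.univ)) ×ˢ s i := by
    ext p
    simp only [Set.mem_preimage, Set.mem_pi, Set.mem_univ, true_imp_iff, Set.mem_prod]
    constructor
    · intro h
      refine ⟨fun j => ?_, by simpa using h i⟩
      by_cases hj : j = i
      · subst hj; simp
      · simpa [Function.update_of_ne hj] using h j
    · rintro ⟨h, hi⟩ j
      by_cases hj : j = i
      · subst hj; simpa using hi
      · simpa [Function.update_of_ne hj] using h j
  rw [this, Measure.prod_prod, Measure.pi_pi, ← Finset.mul_prod_erase _ _ (Finset.mem_univ i),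
    ← Finset.mul_prod_erase (a := i) _ _ (Finset.mem_univ i)]
  simp only [Function.update_self, measure_univ, one_mul]
  rw [mul_comm]
  congr 1
  refine Finset.prod_congr rfl fun j hj => ?_
  rw [Function.update_of_ne (Finset.ne_of_mem_erase hj),
    Function.update_of_ne (Finset.ne_of_mem_erase hj)]

/-- The probability with which box `i` is taken if its reward is `y`. -/
def shareAt (F : Fin n → Dist) (i : Fin n) (y : unitInterval) : ℝ :=
  ∫ x, winShare i (Function.update x i y) ∂(jointLaw F)

theorem measurable_winShare_update (i : Fin n) (y : unitInterval) :
    Measurable fun x : Fin n → unitInterval => winShare i (Function.update x i y) :=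
  (measurable_winShare i).comp ((measurable_update_prod i).comp
    (measurable_id.prodMk measurable_const))

theorem integrable_winShare_update (F : Fin n → Dist) (i : Fin n) (y : unitInterval) :
    Integrable (fun x => winShare i (Function.update x i y)) (jointLaw F) :=
  integrable_of_mem_Icc (measurable_winShare_update i y)
    (fun _ => winShare_nonneg _ _) fun _ => winShare_le_one _ _

theorem shareAt_le_one (F : Fin n → Dist) (i : Fin n) (y : unitInterval) : shareAt F i y ≤ 1 :=
  (integral_mono (integrable_winShare_update F i y) (integrable_const 1)
    fun _ => winShare_le_one _ _).trans (by simp)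

/-- The payoff is linear in the deviation: only the function `shareAt` of the realized reward
matters. -/
theorem frictionlessPayoff_update (F : Fin n → Dist) (i : Fin n) (G : Dist) :
    frictionlessPayoff (Function.update F i G) i
      = ∫ y, shareAt F i y ∂(G : Measure unitInterval) := by
  have hm := (measurable_winShare i).comp (measurable_update_prod i)
  rw [frictionlessPayoff, jointLaw_update, integral_map (measurable_update_prod i).aemeasurable
    (measurable_winShare i).aestronglyMeasurable, integral_prod_symm]
  · rfl
  · exact integrable_of_mem_Icc hm (fun _ => winShare_nonneg _ _) fun _ => winShare_le_one _ _

theorem prod_ite_eq_pow (i : Fin n) (a : ℝ) :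
    ∏ j : Fin n, (if j = i then 1 else a) = a ^ (n - 1) := by
  rw [← Finset.mul_prod_erase _ _ (Finset.mem_univ i), if_pos rfl, one_mul,
    Finset.prod_congr rfl fun j hj => if_neg (Finset.ne_of_mem_erase hj)]
  simp

/-- The expectation of a product over the opponents of box `i`. -/
theorem integral_prod_opponents (F : Dist) (i : Fin n) (f : unitInterval → ℝ) :
    ∫ x, ∏ j, (if j = i then 1 else f (x j)) ∂(jointLaw fun _ : Fin n => F)
      = (∫ x, f x ∂(F : Measure unitInterval)) ^ (n - 1) := by
  have h := integral_fintype_prod_eq_prod (𝕜 := ℝ) (fun (j : Fin n) (x : unitInterval) =>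
    if j = i then (1 : ℝ) else f x) (μ := fun _ => (F : Measure unitInterval))
  rw [jointLaw, h, ← prod_ite_eq_pow i]
  refine Finset.prod_congr rfl fun j _ => ?_
  split_ifs <;> simp

theorem measurable_prod_opponents (i : Fin n) {f : unitInterval → ℝ} (hf : Measurable f) :
    Measurable fun x : Fin n → unitInterval => ∏ j, (if j = i then 1 else f (x j)) := by
  refine Finset.measurable_fun_prod _ fun j _ => ?_
  split_ifs
  · exact measurable_const
  · exact hf.comp (measurable_pi_apply j)

theorem prod_opponents_mem_Icc (i : Fin n) {f : unitInterval → ℝ} (h0 : ∀ y, 0 ≤ f y)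
    (h1 : ∀ y, f y ≤ 1) (x : Fin n → unitInterval) :
    0 ≤ ∏ j, (if j = i then 1 else f (x j)) ∧ ∏ j, (if j = i then 1 else f (x j)) ≤ 1 := by
  have : ∀ j, 0 ≤ (if j = i then 1 else f (x j)) := fun j => by
    split_ifs; exacts [zero_le_one, h0 _]
  exact ⟨Finset.prod_nonneg fun j _ => this j, Finset.prod_le_one (fun j _ => this j) fun j _ => by
    split_ifs; exacts [le_rfl, h1 _]⟩

theorem integrable_prod_opponents (F : Fin n → Dist) (i : Fin n) {f : unitInterval → ℝ}
    (hf : Measurable f) (h0 : ∀ y, 0 ≤ f y) (h1 : ∀ y, f y ≤ 1) :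
    Integrable (fun x => ∏ j, (if j = i then 1 else f (x j))) (jointLaw F) :=
  integrable_of_mem_Icc (measurable_prod_opponents i hf)
    (fun x => (prod_opponents_mem_Icc i h0 h1 x).1) fun x => (prod_opponents_mem_Icc i h0 h1 x).2

theorem shareAt_le (F : Dist) (i : Fin n) (y : unitInterval) :
    shareAt (fun _ => F) i y ≤ cumulative F y ^ (n - 1) := by
  rw [← integral_le_indicator, ← integral_prod_opponents F i]
  have h0 : ∀ x : unitInterval, (0 : ℝ) ≤ if x ≤ y then 1 else 0 := fun x => by split_ifs <;> simp
  have h1 : ∀ x : unitInterval, (if x ≤ y then (1 : ℝ) else 0) ≤ 1 := fun x => by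
    split_ifs <;> simp
  refine integral_mono (integrable_winShare_update _ i y) (integrable_prod_opponents _ i
    (Measurable.ite measurableSet_Iic measurable_const measurable_const) h0 h1) fun x => ?_
  by_cases h : ∀ j, j ≠ i → x j ≤ y
  · refine (winShare_le_one _ _).trans (le_of_eq (Finset.prod_eq_one fun j _ => ?_).symm)
    by_cases hj : j = i
    · simp [hj]
    · simp [hj, h j hj]
  · refine le_trans (le_of_eq ?_) (prod_opponents_mem_Icc i h0 h1 x).1
    rw [winShare, if_neg]
    intro h2
    refine h fun j hj => ?_
    simpa [Function.update_of_ne hj] using h2 j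

theorem le_shareAt (F : Dist) (i : Fin n) (y : unitInterval) :
    (F : Measure unitInterval).real (Set.Iio y) ^ (n - 1) ≤ shareAt (fun _ => F) i y := by
  have e : (fun x : unitInterval => if x < y then (1 : ℝ) else 0) = (Set.Iio y).indicator 1 := by
    ext x; simp [Set.indicator_apply]
  have h0 : ∀ x : unitInterval, (0 : ℝ) ≤ if x < y then 1 else 0 := fun x => by split_ifs <;> simp
  have h1 : ∀ x : unitInterval, (if x < y then (1 : ℝ) else 0) ≤ 1 := fun x => by
    split_ifs <;> simp
  rw [← integral_indicator_one measurableSet_Iio, ← e, ← integral_prod_opponents F i]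
  refine integral_mono (integrable_prod_opponents _ i
    (Measurable.ite measurableSet_Iio measurable_const measurable_const) h0 h1)
    (integrable_winShare_update _ i y) fun x => ?_
  by_cases h : ∀ j, j ≠ i → x j < y
  · refine (prod_opponents_mem_Icc i h0 h1 x).2.trans (le_of_eq ?_)
    have hb : bestOpened Finset.univ (Function.update x i y) = {i} := by
      ext k
      rw [mem_bestOpened, Finset.mem_singleton]
      constructor
      · rintro ⟨-, h2⟩
        by_contra hk
        have := h2 i (Finset.mem_univ i)
        rw [Function.update_self, Function.update_of_ne hk] at this
        exact absurd (h k hk) (not_lt.2 this)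
      · rintro rfl
        refine ⟨Finset.mem_univ _, fun j _ => ?_⟩
        by_cases hj : j = k
        · rw [hj]
        · rw [Function.update_self, Function.update_of_ne hj]
          exact (h j hj).le
    rw [winShare_eq, hb]
    simp
  · push Not at h
    obtain ⟨j, hj, hxj⟩ := h
    refine le_trans (le_of_eq (Finset.prod_eq_zero (Finset.mem_univ j) ?_)) (winShare_nonneg _ _)
    simp [hj, not_lt.2 hxj]

/-! ### Ties at the top reward -/

theorem integral_unitInterval (f : ℝ → ℝ) : ∫ t : unitInterval, f t = ∫ t in (0 : ℝ)..1, f t := by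
  rw [intervalIntegral.integral_of_le zero_le_one, ← integral_Icc_eq_integral_Ioc]
  exact integral_subtype measurableSet_Icc f

/-- The probability with which a box is taken if its reward is `1`. -/
theorem shareAt_one (F : Dist) (i : Fin n) :
    shareAt (fun _ => F) i 1
      = ∫ t in (0 : ℝ)..1, (1 - (F : Measure unitInterval).real {1} * (1 - t)) ^ (n - 1) := by
  classical
  -- With `k` opponents also at 1 the share is `1 / (k + 1)`, the integral of `t ^ k` over `[0, 1]`.
  -- In this form it is a product over independent opponents.
  have hwin : ∀ x : Fin n → unitInterval, winShare i (Function.update x i 1)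
      = ∫ t : unitInterval, ∏ j, (if j = i then 1 else if x j = 1 then (t : ℝ) else 1) := by
    intro x
    set s : Finset (Fin n) := Finset.univ.filter fun j => j ≠ i ∧ x j = 1
    have hb : bestOpened Finset.univ (Function.update x i 1) = insert i s := by
      ext k
      rw [mem_bestOpened, Finset.mem_insert]
      constructor
      · rintro ⟨-, h⟩
        by_cases hk : k = i
        · exact Or.inl hk
        · have := h i (Finset.mem_univ i)
          rw [Function.update_self, Function.update_of_ne hk] at this
          exact Or.inr (Finset.mem_filter.2 ⟨Finset.mem_univ _, hk, le_antisymm le_top this⟩)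
      · intro h
        refine ⟨Finset.mem_univ _, fun j _ => ?_⟩
        have : Function.update x i 1 k = 1 := by
          by_cases hk : k = i
          · rw [hk, Function.update_self]
          · rw [Function.update_of_ne hk]
            have : k ∈ s := h.resolve_left hk
            simp only [s, Finset.mem_filter] at this
            exact this.2.2
        rw [this]
        exact le_top
    have hs : i ∉ s := by simp [s]
    have hprod : ∀ t : unitInterval,
        ∏ j, (if j = i then 1 else if x j = 1 then (t : ℝ) else 1) = (t : ℝ) ^ s.card := by
      intro t
      rw [← Finset.prod_const, Finset.prod_filter]
      refine Finset.prod_congr rfl fun j _ => ?_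
      by_cases hj : j = i <;> simp [hj]
    simp only [hprod]
    rw [integral_unitInterval fun t => t ^ s.card, integral_pow, winShare_eq, hb,
      Finset.card_insert_of_notMem hs]
    simp
  have hatom : ∀ t : ℝ, ∫ x : unitInterval, (if x = 1 then t else 1) ∂(F : Measure unitInterval)
      = 1 - (F : Measure unitInterval).real {1} * (1 - t) := by
    intro t
    have e : (fun x : unitInterval => if x = 1 then t else 1)
        = fun x => 1 - ({1} : Set unitInterval).indicator 1 x * (1 - t) := by
      ext x
      by_cases hx : x = 1 <;> simp [hx]
    rw [e, integral_sub (integrable_const _)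
      (((integrable_const 1).indicator (measurableSet_singleton 1)).mul_const _),
      integral_mul_const, integral_indicator_one (measurableSet_singleton 1)]
    simp
  rw [shareAt]
  simp only [hwin]
  rw [integral_integral_swap]
  · rw [← integral_unitInterval fun t =>
      (1 - (F : Measure unitInterval).real {1} * (1 - t)) ^ (n - 1)]
    congr 1
    ext t
    rw [← hatom]
    exact integral_prod_opponents F i fun x => if x = 1 then (t : ℝ) else 1
  · have h0 : ∀ (t x : unitInterval), (0 : ℝ) ≤ if x = 1 then (t : ℝ) else 1 := fun t x => by
      split_ifs; exacts [t.2.1, zero_le_one]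
    have h1 : ∀ (t x : unitInterval), (if x = 1 then (t : ℝ) else 1) ≤ 1 := fun t x => by
      split_ifs; exacts [t.2.2, le_rfl]
    refine integrable_of_mem_Icc ?_ (fun p => (prod_opponents_mem_Icc i (h0 p.2) (h1 p.2) p.1).1)
      fun p => (prod_opponents_mem_Icc i (h0 p.2) (h1 p.2) p.1).2
    refine Finset.measurable_fun_prod _ fun j _ => ?_
    split_ifs
    · exact measurable_const
    · refine Measurable.ite ?_ (measurable_subtype_coe.comp measurable_snd) measurable_const
      exact ((measurable_pi_apply j).comp measurable_fst) (measurableSet_singleton 1)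

theorem integral_affine_pow (n : ℕ) (r : ℝ) :
    n * r * ∫ t in (0 : ℝ)..1, (1 - r * (1 - t)) ^ (n - 1) = 1 - (1 - r) ^ n := by
  have hd : ∀ t ∈ Set.uIcc (0 : ℝ) 1, HasDerivAt (fun t : ℝ => (1 - r * (1 - t)) ^ n)
      (n * r * (1 - r * (1 - t)) ^ (n - 1)) t := by
    intro t _
    have h1 : HasDerivAt (fun t : ℝ => 1 - r * (1 - t)) r t := by
      have := (((hasDerivAt_id t).const_sub 1).const_mul r).const_sub 1
      simpa using this
    exact (h1.pow n).congr_deriv (by ring)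
  rw [← intervalIntegral.integral_const_mul, intervalIntegral.integral_eq_sub_of_hasDerivAt hd]
  · simp
  · exact (by fun_prop : Continuous fun t : ℝ => n * r * (1 - r * (1 - t)) ^ (n - 1)).intervalIntegrable
      _ _

theorem integral_affine_pow_anti {a b : ℝ} (hab : a ≤ b) (hb : b ≤ 1) (k : ℕ) :
    ∫ t in (0 : ℝ)..1, (1 - b * (1 - t)) ^ k ≤ ∫ t in (0 : ℝ)..1, (1 - a * (1 - t)) ^ k := by
  refine intervalIntegral.integral_mono_on zero_le_one
    ((by fun_prop : Continuous fun t : ℝ => (1 - b * (1 - t)) ^ k).intervalIntegrable _ _)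
    ((by fun_prop : Continuous fun t : ℝ => (1 - a * (1 - t)) ^ k).intervalIntegrable _ _)
    fun t ht => ?_
  have h1 : 0 ≤ 1 - t := sub_nonneg.2 ht.2
  refine pow_le_pow_left₀ ?_ (by nlinarith) k
  nlinarith [ht.1]

/-! ### Existence of a symmetric equilibrium without frictions -/

/-- A linear bound integrates against every distribution of mean `μ` to `1 / n`. Payoffs sum to 1,
so in the symmetric profile each of them attains this bound. -/
theorem isFrictionlessEquilibrium_of_shareAt_le {μ : ℝ} (hμ : 0 < μ) (hn : n ≠ 0) {F : Dist}
    (hF : F ∈ feasible μ)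
    (h : ∀ (i : Fin n) (y : unitInterval), shareAt (fun _ => F) i y ≤ 1 / (n * μ) * y) :
    IsFrictionlessEquilibrium μ fun _ : Fin n => F := by
  have hn0 : (n : ℝ) ≠ 0 := Nat.cast_ne_zero.2 hn
  have hle : ∀ i, ∀ G ∈ feasible μ,
      frictionlessPayoff (Function.update (fun _ : Fin n => F) i G) i ≤ 1 / n := by
    intro i G hG
    rw [frictionlessPayoff_update]
    refine (integral_le_integral_of_nonneg ((integrable_coe G).const_mul (1 / (n * μ)))
      (fun y => mul_nonneg (by positivity) y.2.1) (h i)).trans (le_of_eq ?_)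
    rw [integral_const_mul, show ∫ x : unitInterval, (x : ℝ) ∂(G : Measure unitInterval) = μ from hG]
    field_simp
  have hself : ∀ i, frictionlessPayoff (fun _ : Fin n => F) i ≤ 1 / n := by
    intro i
    have := hle i F hF
    rwa [show Function.update (fun _ : Fin n => F) i F = fun _ => F from
      Function.update_eq_self i _] at this
  have heq : ∀ i, frictionlessPayoff (fun _ : Fin n => F) i = 1 / n := by
    have hsum : ∑ i : Fin n, frictionlessPayoff (fun _ : Fin n => F) i = ∑ _i : Fin n, 1 / (n : ℝ) := by
      rw [sum_frictionlessPayoff hn]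
      simp [hn0]
    intro i
    exact (Finset.sum_eq_sum_iff_of_le fun i _ => hself i).1 hsum i (Finset.mem_univ i)
  exact ⟨fun _ => hF, fun i G hG => (hle i G hG).trans (heq i).ge⟩

/-- The quantile function of the equilibrium distribution: a power of a uniform random variable
below `q` and an atom at `1` above. -/
def quantile (n : ℕ) (μ q : ℝ) (u : unitInterval) : unitInterval :=
  if (u : ℝ) ≤ q then Set.projIcc 0 1 zero_le_one (n * μ * (u : ℝ) ^ (n - 1)) else 1

theorem measurable_quantile (n : ℕ) (μ q : ℝ) : Measurable (quantile n μ q) := by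
  refine Measurable.ite (measurableSet_le measurable_subtype_coe measurable_const) ?_
    measurable_const
  exact (continuous_projIcc.comp (by fun_prop)).measurable

/-- The equilibrium distribution with atom `1 - q` at the top. -/
def equilibriumDist (n : ℕ) (μ q : ℝ) : Dist :=
  ⟨(volume : Measure unitInterval).map (quantile n μ q),
    Measure.isProbabilityMeasure_map (measurable_quantile n μ q).aemeasurable⟩

theorem coe_quantile_of_le {μ q : ℝ} (hμ : 0 ≤ μ) (hq : n * μ * q ^ (n - 1) ≤ 1)
    {u : unitInterval} (hu : (u : ℝ) ≤ q) : (quantile n μ q u : ℝ) = n * μ * (u : ℝ) ^ (n - 1) := by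
  have h0 : 0 ≤ n * μ * (u : ℝ) ^ (n - 1) := by have := u.2.1; positivity
  have h1 : n * μ * (u : ℝ) ^ (n - 1) ≤ 1 := by
    refine le_trans ?_ hq
    gcongr
    exact u.2.1
  rw [quantile, if_pos hu, Set.coe_projIcc, min_eq_right h1, max_eq_right h0]

theorem real_equilibriumDist (n : ℕ) (μ q : ℝ) {s : Set unitInterval} (hs : MeasurableSet s) :
    (equilibriumDist n μ q : Measure unitInterval).real s
      = (volume : Measure unitInterval).real (quantile n μ q ⁻¹' s) :=
  map_measureReal_apply (measurable_quantile n μ q) hs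

theorem integral_coe_equilibriumDist {μ q : ℝ} (hn : n ≠ 0) (hμ : 0 ≤ μ) (hq0 : 0 ≤ q)
    (hq1 : q ≤ 1) (hq : n * μ * q ^ (n - 1) ≤ 1) :
    ∫ x : unitInterval, (x : ℝ) ∂(equilibriumDist n μ q : Measure unitInterval)
      = μ * q ^ n + (1 - q) := by
  change ∫ x : unitInterval, (x : ℝ) ∂((volume : Measure unitInterval).map (quantile n μ q)) = _
  rw [integral_map (measurable_quantile n μ q).aemeasurable
    measurable_subtype_coe.aestronglyMeasurable]
  have e : ∀ u : unitInterval, (quantile n μ q u : ℝ)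
      = (fun t : ℝ => if t ≤ q then n * μ * t ^ (n - 1) else 1) u := by
    intro u
    by_cases hu : (u : ℝ) ≤ q
    · rw [coe_quantile_of_le hμ hq hu]; simp [hu]
    · simp [quantile, hu]
  simp only [e]
  rw [integral_unitInterval fun t : ℝ => if t ≤ q then n * μ * t ^ (n - 1) else 1]
  have c1 : ∀ a b : ℝ, IntervalIntegrable (fun t : ℝ => n * μ * t ^ (n - 1)) volume a b :=
    (by fun_prop : Continuous fun t : ℝ => n * μ * t ^ (n - 1)).intervalIntegrable
  have e1 : Set.EqOn (fun t : ℝ => n * μ * t ^ (n - 1))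
      (fun t : ℝ => if t ≤ q then n * μ * t ^ (n - 1) else 1) (Set.uIoc 0 q) := by
    intro t ht
    rw [Set.uIoc_of_le hq0] at ht
    simp [ht.2]
  have e2 : Set.EqOn (fun _ : ℝ => (1 : ℝ))
      (fun t : ℝ => if t ≤ q then n * μ * t ^ (n - 1) else 1) (Set.uIoc q 1) := by
    intro t ht
    rw [Set.uIoc_of_le hq1] at ht
    simp [ht.1]
  rw [← intervalIntegral.integral_add_adjacent_intervals ((c1 0 q).congr e1)
    ((_root_.intervalIntegrable_const).congr e2),
    ← intervalIntegral.integral_congr_ae (Filter.Eventually.of_forall fun _ ht => e1 ht),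
    ← intervalIntegral.integral_congr_ae (Filter.Eventually.of_forall fun _ ht => e2 ht)]
  have hn1 : n - 1 + 1 = n := Nat.sub_add_cancel (Nat.pos_of_ne_zero hn)
  have hn2 : ((n - 1 : ℕ) : ℝ) + 1 = n := by exact_mod_cast hn1
  rw [intervalIntegral.integral_const_mul, integral_pow, hn1, hn2]
  have : (n : ℝ) ≠ 0 := Nat.cast_ne_zero.2 hn
  simp [hn]
  field_simp

theorem le_equilibriumDist_atom (n : ℕ) {μ q : ℝ} (hq0 : 0 ≤ q) (hq1 : q ≤ 1) :
    1 - q ≤ (equilibriumDist n μ q : Measure unitInterval).real {1} := by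
  rw [real_equilibriumDist n μ q (measurableSet_singleton 1)]
  have h : (volume : Measure unitInterval).real (Set.Ioi ⟨q, hq0, hq1⟩) = 1 - q := by
    rw [Measure.real, unitInterval.volume_Ioi, ENNReal.toReal_ofReal (sub_nonneg.2 hq1)]
  rw [← h]
  refine measureReal_mono fun u hu => ?_
  have : ¬ (u : ℝ) ≤ q := not_le.2 hu
  simp [quantile, this]

/-- Below 1 the quantile is `n * μ * u ^ (n - 1)`, so a reward at most `y` means `u ^ (n - 1) ≤ y /
(n * μ)`. -/
theorem cumulative_equilibriumDist_pow_le {μ q : ℝ} (hn : 2 ≤ n) (hμ : 0 < μ)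
    (hq : n * μ * q ^ (n - 1) ≤ 1) {y : unitInterval} (hy : y < 1) :
    cumulative (equilibriumDist n μ q) y ^ (n - 1) ≤ 1 / (n * μ) * y := by
  have hn0 : (0 : ℝ) < n := by positivity
  have hn1 : n - 1 ≠ 0 := by omega
  have hnμ : 0 < n * μ := by positivity
  rcases le_or_gt (n * μ) y with h | h
  · refine (pow_le_one₀ (cumulative_nonneg _ _) (cumulative_le_one _ _)).trans ?_
    rw [one_div, inv_mul_eq_div, le_div_iff₀ hnμ]
    linarith
  · have hw0 : 0 ≤ 1 / (n * μ) * (y : ℝ) := mul_nonneg (by positivity) y.2.1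
    have hw1 : 1 / (n * μ) * (y : ℝ) ≤ 1 := by
      rw [one_div, inv_mul_eq_div, div_le_one hnμ]
      exact h.le
    set r := (1 / (n * μ) * (y : ℝ)) ^ (((n - 1 : ℕ) : ℝ)⁻¹)
    have hr0 : 0 ≤ r := Real.rpow_nonneg hw0 _
    have hr1 : r ≤ 1 := Real.rpow_le_one hw0 hw1 (by positivity)
    have hr : r ^ (n - 1) = 1 / (n * μ) * y := Real.rpow_inv_natCast_pow hw0 hn1
    rw [← hr]
    refine pow_le_pow_left₀ (cumulative_nonneg _ _) ?_ _
    rw [cumulative, real_equilibriumDist n μ q measurableSet_Iic]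
    have hvol : (volume : Measure unitInterval).real (Set.Iic ⟨r, hr0, hr1⟩) = r := by
      rw [Measure.real, unitInterval.volume_Iic, ENNReal.toReal_ofReal hr0]
    refine le_of_le_of_eq (measureReal_mono fun u hu => ?_) hvol
    have hu' : quantile n μ q u ≤ y := hu
    by_cases huq : (u : ℝ) ≤ q
    · have h2 : n * μ * (u : ℝ) ^ (n - 1) ≤ y := by
        rw [← coe_quantile_of_le hμ.le hq huq]
        exact hu'
      have h3 : (u : ℝ) ^ (n - 1) ≤ r ^ (n - 1) := by
        rw [hr, one_div, inv_mul_eq_div, le_div_iff₀ hnμ]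
        linarith
      exact le_of_pow_le_pow_left₀ hn1 hr0 h3
    · rw [quantile, if_neg huq] at hu'
      exact absurd hy (not_lt.2 hu')

/-- If `n * μ ≤ 1`, no atom is needed and `q = 1`. Otherwise `q` is fixed by the mean condition `μ *
(1 - q ^ n) = 1 - q`, which also makes the share at reward 1 meet the linear bound. -/
theorem exists_isFrictionlessEquilibrium {μ : ℝ} (hn : 2 ≤ n) (hμ0 : 0 < μ) (hμ1 : μ < 1) :
    ∃ F : Dist, IsFrictionlessEquilibrium μ fun _ : Fin n => F := by
  have hn0 : n ≠ 0 := by omega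
  have hnpos : (0 : ℝ) < n := by positivity
  obtain ⟨q, hq0, hq1, hq, hor⟩ : ∃ q : ℝ, 0 ≤ q ∧ q ≤ 1 ∧ n * μ * q ^ (n - 1) ≤ 1 ∧
      (q = 1 ∨ μ * (1 - q ^ n) = 1 - q ∧ q ≠ 1) := by
    rcases le_or_gt (n * μ) 1 with h | h
    · exact ⟨1, zero_le_one, le_rfl, by simpa using h, Or.inl rfl⟩
    -- Dividing the mean condition by `1 - q` gives a geometric sum, which removes the spurious root
    -- `q = 1`.
    · have hcont : Continuous fun q : ℝ => μ * ∑ k ∈ Finset.range n, q ^ k := by fun_prop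
      have h0 : (fun q : ℝ => μ * ∑ k ∈ Finset.range n, q ^ k) 0 ≤ 1 := by
        have : ∑ k ∈ Finset.range n, (0 : ℝ) ^ k = 1 := by
          rw [Finset.sum_eq_single 0]
          · simp
          · intro k _ hk; simp [hk]
          · simp [hn0]
        simp only [this]
        linarith
      have h1 : 1 ≤ (fun q : ℝ => μ * ∑ k ∈ Finset.range n, q ^ k) 1 := by
        simp
        linarith
      obtain ⟨q, ⟨hq0, hq1⟩, hq⟩ := intermediate_value_Icc zero_le_one hcont.continuousOn ⟨h0, h1⟩
      simp only at hq
      have hgeom : (∑ k ∈ Finset.range n, q ^ k) * (q - 1) = q ^ n - 1 := geom_sum_mul q n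
      refine ⟨q, hq0, hq1, ?_, Or.inr ⟨?_, ?_⟩⟩
      · have : ∑ _k ∈ Finset.range n, q ^ (n - 1) ≤ ∑ k ∈ Finset.range n, q ^ k := by
          refine Finset.sum_le_sum fun k hk => pow_le_pow_of_le_one hq0 hq1 ?_
          have := Finset.mem_range.1 hk
          omega
        rw [Finset.sum_const, Finset.card_range, nsmul_eq_mul] at this
        nlinarith [mul_le_mul_of_nonneg_left this hμ0.le]
      · linear_combination μ * hgeom - (q - 1) * hq
      · rintro rfl
        simp at hq
        linarith
  have hmean : μ * q ^ n + (1 - q) = μ := by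
    rcases hor with rfl | ⟨h, -⟩
    · simp
    · linarith
  refine ⟨equilibriumDist n μ q, isFrictionlessEquilibrium_of_shareAt_le hμ0 hn0
    ((integral_coe_equilibriumDist hn0 hμ0.le hq0 hq1 hq).trans hmean) fun i y => ?_⟩
  rcases eq_or_lt_of_le (show y ≤ 1 from le_top) with rfl | hy
  · rcases hor with rfl | ⟨h, hne⟩
    · refine (shareAt_le_one _ _ _).trans ?_
      have : n * μ ≤ 1 := by simpa using hq
      simp only [Set.Icc.coe_one, mul_one]
      rw [le_div_iff₀ (by positivity)]
      linarith
    · rw [shareAt_one]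
      -- The share at 1 decreases in the atom; for an atom of exactly `1 - q` it is `(1 - q ^ n) /
      -- (n * (1 - q)) = 1 / (n * μ)`.
      refine (integral_affine_pow_anti (le_equilibriumDist_atom n hq0 hq1) measureReal_le_one
        (n - 1)).trans (le_of_eq ?_)
      have h2 := integral_affine_pow n (1 - q)
      have h3 : 0 < 1 - q := sub_pos.2 (lt_of_le_of_ne hq1 hne)
      rw [sub_sub_cancel] at h2
      simp only [Set.Icc.coe_one, mul_one]
      rw [eq_div_iff (by positivity)]
      have h4 : (1 - q) * ((∫ t in (0 : ℝ)..1, (1 - (1 - q) * (1 - t)) ^ (n - 1)) * (n * μ))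
          = (1 - q) * 1 := by
        linear_combination μ * h2 + h
      exact mul_left_cancel₀ h3.ne' h4
  · exact (shareAt_le _ i y).trans (cumulative_equilibriumDist_pow_le hn hμ0 hq hy)

/-! ### The searcher's utility in symmetric equilibria without frictions -/

theorem mul_real_le_of_mem_feasible {μ : ℝ} {F : Dist} (hF : F ∈ feasible μ) {b : ℝ}
    {s : Set unitInterval} (hs : MeasurableSet s) (h : ∀ x ∈ s, b ≤ (x : ℝ)) :
    b * (F : Measure unitInterval).real s ≤ μ := by
  rw [← show ∫ x : unitInterval, (x : ℝ) ∂(F : Measure unitInterval) = μ from hF,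
    ← integral_indicator_one hs, ← integral_const_mul]
  refine integral_mono (((integrable_const 1).indicator hs).const_mul b) (integrable_coe F)
    fun x => ?_
  by_cases hx : x ∈ s
  · simpa [hx] using h x hx
  · simpa [hx] using x.2.1

/-- The mean bounds the atom at 1 by `μ`, and a smaller atom means fewer ties at the top. -/
theorem le_shareAt_one {μ : ℝ} (hμ0 : 0 < μ) (hμ1 : μ ≤ 1) (hn : n ≠ 0) {F : Dist}
    (hF : F ∈ feasible μ) (i : Fin n) :
    (1 - (1 - μ) ^ n) / (n * μ) ≤ shareAt (fun _ => F) i 1 := by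
  have ha : (F : Measure unitInterval).real {1} ≤ μ := by
    simpa using mul_real_le_of_mem_feasible hF (b := 1) (measurableSet_singleton 1) (by simp)
  have hn0 : (0 : ℝ) < n := Nat.cast_pos.2 (Nat.pos_of_ne_zero hn)
  rw [shareAt_one, ← integral_affine_pow n μ, mul_div_cancel_left₀ _ (by positivity)]
  exact integral_affine_pow_anti ha hμ1 (n - 1)

/-- In a symmetric equilibrium, spreading a box's reward on `ε` and `1` does not pay. -/
theorem IsFrictionlessEquilibrium.two_point_le {μ : ℝ} (hn : n ≠ 0) (hμ1 : μ < 1) {F : Dist}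
    (h : IsFrictionlessEquilibrium μ fun _ : Fin n => F) {ε : ℝ} (hε0 : 0 < ε) (hε : ε < μ) :
    ∃ y : unitInterval, (y : ℝ) = ε ∧
      (μ - ε) / (1 - ε) * ((1 - (1 - μ) ^ n) / (n * μ))
        + (1 - (μ - ε) / (1 - ε)) * (F : Measure unitInterval).real (Set.Iio y) ^ (n - 1)
        ≤ 1 / n := by
  have hε1 : 0 < 1 - ε := by linarith
  have hl0 : 0 ≤ (μ - ε) / (1 - ε) := div_nonneg (by linarith) hε1.le
  have hl1 : (μ - ε) / (1 - ε) ≤ 1 := by rw [div_le_one hε1]; linarith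
  set l : unitInterval := ⟨(μ - ε) / (1 - ε), hl0, hl1⟩
  set y : unitInterval := ⟨ε, hε0.le, by linarith⟩
  have hm : Measurable fun x : unitInterval => x ⊔ y := measurable_id.sup measurable_const
  -- Weight `(μ - ε) / (1 - ε)` on 1 and the rest on `ε` gives mean `μ`; raising the reward 0 of a
  -- prior to `ε` produces this distribution.
  let G : Dist := ⟨(prior l : Measure unitInterval).map fun x => x ⊔ y,
    Measure.isProbabilityMeasure_map hm.aemeasurable⟩
  have hint : ∀ f : unitInterval → ℝ, Measurable f →
      ∫ x, f x ∂(G : Measure unitInterval) = l * f 1 + (1 - l) * f y := by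
    intro f hf
    change ∫ x, f x ∂((prior l : Measure unitInterval).map fun x => x ⊔ y) = _
    rw [integral_map hm.aemeasurable hf.aestronglyMeasurable, integral_prior,
      sup_eq_left.2 (show y ≤ 1 from le_top), sup_eq_right.2 (show 0 ≤ y from bot_le)]
  have hG : G ∈ feasible μ := by
    change ∫ x : unitInterval, (x : ℝ) ∂(G : Measure unitInterval) = μ
    rw [hint _ measurable_subtype_coe]
    simp only [l, y, Set.Icc.coe_one]
    field_simp
    ring
  -- Payoffs sum to 1, so some box gets at most the average; symmetry of the payoffs is not needed.
  obtain ⟨i, -, hi⟩ : ∃ i ∈ (Finset.univ : Finset (Fin n)),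
      frictionlessPayoff (fun _ : Fin n => F) i ≤ 1 / n := by
    have : Nonempty (Fin n) := ⟨⟨0, Nat.pos_of_ne_zero hn⟩⟩
    refine Finset.exists_le_of_sum_le Finset.univ_nonempty ?_
    rw [sum_frictionlessPayoff hn]
    have : (n : ℝ) ≠ 0 := Nat.cast_ne_zero.2 hn
    simp [this]
  have hdev := (h.no_deviation i G hG).trans hi
  have hmeas : Measurable (shareAt (fun _ : Fin n => F) i) := by
    refine StronglyMeasurable.measurable (StronglyMeasurable.integral_prod_left
      (f := fun (x : Fin n → unitInterval) (y : unitInterval) =>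
        winShare i (Function.update x i y)) ?_)
    exact ((measurable_winShare i).comp (measurable_update_prod i)).stronglyMeasurable
  rw [frictionlessPayoff_update, hint _ hmeas] at hdev
  refine ⟨y, rfl, le_trans ?_ hdev⟩
  exact add_le_add
    (mul_le_mul_of_nonneg_left (le_shareAt_one (hε0.trans hε) hμ1.le hn (h.feasible_profile i) i)
      hl0) (mul_le_mul_of_nonneg_left (le_shareAt F i y) (sub_nonneg.2 hl1))

/-- At `s = 0` the right-hand side is `1 / n + (1 - 1 / n) * (1 - μ) ^ n`, the gain from winning all
ties at 0 outright. Continuity leaves room for a small `s`, which serves both as the low reward and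
as slack in the mass below it. -/
theorem exists_pos_two_point_gt {μ : ℝ} (hn : 2 ≤ n) (hμ0 : 0 < μ) (hμ1 : μ < 1) :
    ∃ s : ℝ, 0 < s ∧ s < μ ∧ s < 1 - μ ∧
      1 / n < (μ - s) / (1 - s) * ((1 - (1 - μ) ^ n) / (n * μ))
        + (1 - (μ - s) / (1 - s)) * (1 - μ - s) ^ (n - 1) := by
  have hn0 : (1 : ℝ) < n := by exact_mod_cast hn
  have hcont : ContinuousAt (fun s : ℝ => (μ - s) / (1 - s) * ((1 - (1 - μ) ^ n) / (n * μ))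
        + (1 - (μ - s) / (1 - s)) * (1 - μ - s) ^ (n - 1)) 0 := by
    have : ContinuousAt (fun s : ℝ => (μ - s) / (1 - s)) 0 :=
      ContinuousAt.div (by fun_prop) (by fun_prop) (by simp)
    fun_prop
  have h0 : 1 / (n : ℝ) < (μ - 0) / (1 - 0) * ((1 - (1 - μ) ^ n) / (n * μ))
        + (1 - (μ - 0) / (1 - 0)) * (1 - μ - 0) ^ (n - 1) := by
    have e : (1 - μ) * (1 - μ) ^ (n - 1) = (1 - μ) ^ n := mul_pow_sub_one (by omega) _
    have hp : 0 < (1 - μ) ^ n := pow_pos (by linarith) n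
    have : (1 - μ) ^ n / n < (1 - μ) ^ n := div_lt_self hp hn0
    simp only [sub_zero, div_one]
    rw [e]
    have e2 : μ * ((1 - (1 - μ) ^ n) / (n * μ)) = 1 / n - (1 - μ) ^ n / n := by
      field_simp
    rw [e2]
    linarith
  have hev := (hcont.eventually_const_lt h0).filter_mono (nhdsWithin_le_nhds (s := Set.Ioi 0))
  have hsmall : ∀ᶠ s : ℝ in nhdsWithin 0 (Set.Ioi 0), s ∈ Set.Ioo 0 (min μ (1 - μ)) :=
    Ioo_mem_nhdsGT (lt_min hμ0 (by linarith))
  obtain ⟨s, hs, hs2⟩ := (hev.and hsmall).exists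
  exact ⟨s, hs2.1, hs2.2.trans_le (min_le_left _ _), hs2.2.trans_le (min_le_right _ _), hs⟩

/-- For any second box `l`, `1 - ∏ (1 - x i)` exceeds `x k` by at least `(1 - x k) * x l`, and this
is at least `κ * ε` when all rewards lie in `[ε, 1 - κ]`. -/
theorem iSup_le_sub_prod (hn : 2 ≤ n) {ε κ : ℝ} (hε : 0 ≤ ε)
    (x : Fin n → unitInterval) :
    (⨆ i, (x i : ℝ)) ≤ 1 - ∏ i, (1 - (x i : ℝ))
      - κ * ε * ∏ i, {y : unitInterval | ε ≤ y ∧ (y : ℝ) ≤ 1 - κ}.indicator 1 (x i) := by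
  classical
  have : Nonempty (Fin n) := ⟨⟨0, by omega⟩⟩
  refine ciSup_le fun k => ?_
  have hx0 : ∀ i, 0 ≤ 1 - (x i : ℝ) := fun i => sub_nonneg.2 (x i).2.2
  have hx1 : ∀ i, 1 - (x i : ℝ) ≤ 1 := fun i => sub_le_self _ (x i).2.1
  obtain ⟨l, hl⟩ : ∃ l : Fin n, l ≠ k := by
    have : Nontrivial (Fin n) := Fin.nontrivial_iff_two_le.2 hn
    exact exists_ne k
  have hlk : l ∈ Finset.univ.erase k := Finset.mem_erase.2 ⟨hl, Finset.mem_univ l⟩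
  have hrest : ∏ i ∈ (Finset.univ.erase k).erase l, (1 - (x i : ℝ)) ≤ 1 :=
    Finset.prod_le_one (fun i _ => hx0 i) fun i _ => hx1 i
  have hprod : ∏ i, (1 - (x i : ℝ)) ≤ (1 - x k) * (1 - x l) := by
    rw [← Finset.mul_prod_erase _ _ (Finset.mem_univ k), ← Finset.mul_prod_erase _ _ hlk]
    exact mul_le_mul_of_nonneg_left (mul_le_of_le_one_right (hx0 l) hrest) (hx0 k)
  by_cases h : ∀ i, ε ≤ (x i : ℝ) ∧ (x i : ℝ) ≤ 1 - κ
  · have : ∏ i, {y : unitInterval | ε ≤ y ∧ (y : ℝ) ≤ 1 - κ}.indicator (1 : unitInterval → ℝ) (x i)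
        = 1 := Finset.prod_eq_one fun i _ => by
          rw [Set.indicator_of_mem]
          · rfl
          · exact h i
    rw [this]
    have h1 : κ * ε ≤ (1 - x k) * x l :=
      mul_le_mul (by linarith [(h k).2]) (h l).1 hε (hx0 k)
    nlinarith
  · push Not at h
    obtain ⟨j, hj⟩ := h
    have hzero : ∏ i, {y : unitInterval | ε ≤ y ∧ (y : ℝ) ≤ 1 - κ}.indicator
        (1 : unitInterval → ℝ) (x i) = 0 := Finset.prod_eq_zero (Finset.mem_univ j)
      (Set.indicator_of_notMem (fun h => absurd (hj h.1) (not_lt.2 h.2)) _)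
    have := mul_le_of_le_one_right (hx0 k) (hx1 l)
    rw [hzero]
    linarith

theorem frictionlessUtility_le (hn : 2 ≤ n) {μ : ℝ} {F : Dist} (hF : F ∈ feasible μ) {ε κ : ℝ}
    (hε : 0 ≤ ε) :
    frictionlessUtility (fun _ : Fin n => F) ≤ 1 - (1 - μ) ^ n - κ * ε *
      (F : Measure unitInterval).real {y | ε ≤ y ∧ (y : ℝ) ≤ 1 - κ} ^ n := by
  set s : Set unitInterval := {y | ε ≤ y ∧ (y : ℝ) ≤ 1 - κ}
  have hs : MeasurableSet s := (measurableSet_le measurable_const measurable_subtype_coe).inter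
    (measurableSet_le measurable_subtype_coe measurable_const)
  have hprod : ∀ f : unitInterval → ℝ,
      ∫ x, ∏ i, f (x i) ∂(jointLaw fun _ : Fin n => F)
        = (∫ x, f x ∂(F : Measure unitInterval)) ^ n := by
    intro f
    rw [jointLaw, integral_fintype_prod_eq_pow (𝕜 := ℝ) f, Fintype.card_fin]
  have hint : ∀ f : unitInterval → ℝ, Measurable f → (∀ y, 0 ≤ f y) → (∀ y, f y ≤ 1) →
      Integrable (fun x : Fin n → unitInterval => ∏ i, f (x i)) (jointLaw fun _ : Fin n => F) :=
    fun f hf h0 h1 => integrable_of_mem_Icc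
      (Finset.measurable_fun_prod _ fun i _ => hf.comp (measurable_pi_apply i))
      (fun x => Finset.prod_nonneg fun i _ => h0 _)
      (fun x => Finset.prod_le_one (fun i _ => h0 _) fun i _ => h1 _)
  have hi1 := hint (fun y => 1 - (y : ℝ)) (measurable_const.sub measurable_subtype_coe)
    (fun y => sub_nonneg.2 y.2.2) (fun y => sub_le_self _ y.2.1)
  have hi2 := hint (s.indicator 1) (measurable_one.indicator hs)
    (fun y => Set.indicator_nonneg (fun _ _ => zero_le_one) y)
    (fun y => Set.indicator_le' (g := 1) (fun _ _ => le_rfl) (fun _ _ => zero_le_one) y)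
  have hi3 : Integrable (fun x : Fin n → unitInterval => 1 - ∏ i, (1 - (x i : ℝ)))
      (jointLaw fun _ : Fin n => F) := (integrable_const 1).sub hi1
  have hle : frictionlessUtility (fun _ : Fin n => F)
      ≤ ∫ x : Fin n → unitInterval, (1 - ∏ i, (1 - (x i : ℝ)) - κ * ε * ∏ i, s.indicator 1 (x i))
        ∂(jointLaw fun _ : Fin n => F) := by
    refine integral_mono_of_nonneg (Filter.Eventually.of_forall fun x =>
      Real.iSup_nonneg fun i => (x i).2.1) (hi3.sub (hi2.const_mul _))
      (Filter.Eventually.of_forall fun x => iSup_le_sub_prod hn hε x)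
  refine hle.trans (le_of_eq ?_)
  rw [integral_sub hi3 (hi2.const_mul _),
    integral_sub (integrable_const 1) hi1, integral_const_mul, hprod (s.indicator 1),
    hprod fun y => 1 - (y : ℝ), integral_indicator_one hs,
    integral_sub (integrable_const 1) (integrable_coe F),
    show ∫ x : unitInterval, (x : ℝ) ∂(F : Measure unitInterval) = μ from hF]
  simp

/-- The utility in symmetric equilibria is bounded away from that under full information. -/
theorem exists_gap {μ : ℝ} (hn : 2 ≤ n) (hμ0 : 0 < μ) (hμ1 : μ < 1) :
    ∃ δ : ℝ, 0 < δ ∧ ∀ F : Dist, IsFrictionlessEquilibrium μ (fun _ : Fin n => F) →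
      frictionlessUtility (fun _ : Fin n => F) ≤ 1 - (1 - μ) ^ n - δ := by
  obtain ⟨s, hs0, hsμ, hs1, hs⟩ := exists_pos_two_point_gt hn hμ0 hμ1
  -- The mass below `s` is less than `1 - μ - s`, since otherwise the two-point deviation would pay;
  -- by Markov's inequality the mass above `1 - s / 4` is at most `μ + s / 2`. At least `s / 2`
  -- remains in between, and `frictionlessUtility_le` with `ε = s` and `κ = s / 4` gives this gap.
  refine ⟨s / 4 * s * (s / 2) ^ n, by positivity, fun F hF => ?_⟩
  have hfe : F ∈ feasible μ := hF.feasible_profile ⟨0, by omega⟩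
  obtain ⟨y, hy, hle⟩ := hF.two_point_le (by omega) hμ1 hs0 hsμ
  have hlow : (F : Measure unitInterval).real (Set.Iio y) < 1 - μ - s := by
    by_contra! hge
    have h1 := pow_le_pow_left₀ (by linarith) hge (n - 1)
    have h2 : 0 ≤ 1 - (μ - s) / (1 - s) := by
      rw [sub_nonneg, div_le_one (by linarith)]
      linarith
    have h3 := mul_le_mul_of_nonneg_left h1 h2
    linarith
  have hhigh : (F : Measure unitInterval).real {x | 1 - s / 4 < (x : ℝ)} ≤ μ + s / 2 := by
    have h1 := mul_real_le_of_mem_feasible hfe (b := 1 - s / 4)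
      (s := {x | 1 - s / 4 < (x : ℝ)}) (measurableSet_lt measurable_const measurable_subtype_coe)
      fun x hx => le_of_lt hx
    have h2 : μ ≤ (1 - s / 4) * (μ + s / 2) := by nlinarith
    exact le_of_mul_le_mul_left (h1.trans h2) (by linarith)
  have hmid : s / 2 ≤ (F : Measure unitInterval).real {x | s ≤ x ∧ (x : ℝ) ≤ 1 - s / 4} := by
    have hcover : (Set.univ : Set unitInterval) ⊆
        (Set.Iio y ∪ {x | s ≤ x ∧ (x : ℝ) ≤ 1 - s / 4}) ∪ {x | 1 - s / 4 < (x : ℝ)} := by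
      intro x _
      rcases lt_or_ge (x : ℝ) s with h | h
      · exact Or.inl (Or.inl (show (x : ℝ) < y by rwa [hy]))
      · rcases le_or_gt (x : ℝ) (1 - s / 4) with h2 | h2
        · exact Or.inl (Or.inr ⟨h, h2⟩)
        · exact Or.inr h2
    have h1 := measureReal_mono (μ := (F : Measure unitInterval)) hcover
    rw [probReal_univ] at h1
    have h2 := measureReal_union_le (μ := (F : Measure unitInterval))
      (Set.Iio y ∪ {x | s ≤ x ∧ (x : ℝ) ≤ 1 - s / 4}) {x | 1 - s / 4 < (x : ℝ)}
    have h3 := measureReal_union_le (μ := (F : Measure unitInterval))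
      (Set.Iio y) {x | s ≤ x ∧ (x : ℝ) ≤ 1 - s / 4}
    linarith
  refine (frictionlessUtility_le (κ := s / 4) hn hfe hs0.le).trans ?_
  have := pow_le_pow_left₀ (by positivity) hmid n
  have := mul_le_mul_of_nonneg_left this (by positivity : 0 ≤ s / 4 * s)
  linarith

end PandoraSearch

end

/-! ### Choice of the friction bounds -/

theorem theorem9 (n : ℕ) (hn : 2 ≤ n) (μ : unitInterval) (hμ0 : 0 < (μ : ℝ)) (hμ1 : (μ : ℝ) < 1)
    (hμn : 1 - (1 / (n : ℝ)) ^ (1 / ((n : ℝ) - 1)) ≤ (μ : ℝ)) :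
    (∃ F : PandoraSearch.Dist,
      PandoraSearch.IsFrictionlessEquilibrium (μ : ℝ) (fun _ : Fin n => F)) ∧
    ∃ βhat : ℝ, βhat < 1 ∧ ∃ chat : ℝ, 0 < chat ∧
      ∀ β c : ℝ, βhat < β → β ≤ 1 → 0 ≤ c → c < chat → (β < 1 ∨ 0 < c) →
        (∃ η : (Fin n → PandoraSearch.Dist) → PandoraSearch.Policy n,
          PandoraSearch.IsFSPE (μ : ℝ) β c η (fun _ : Fin n => PandoraSearch.prior μ)) ∧
        ∀ η : (Fin n → PandoraSearch.Dist) → PandoraSearch.Policy n,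
          PandoraSearch.IsFSPE (μ : ℝ) β c η (fun _ : Fin n => PandoraSearch.prior μ) →
          ∀ F : PandoraSearch.Dist,
            PandoraSearch.IsFrictionlessEquilibrium (μ : ℝ) (fun _ : Fin n => F) →
            PandoraSearch.frictionlessUtility (fun _ : Fin n => F) <
              PandoraSearch.searchUtility β c (fun _ : Fin n => PandoraSearch.prior μ)
                (η (fun _ : Fin n => PandoraSearch.prior μ)) := by
  have hpow : (1 - (μ : ℝ)) ^ (n - 1) ≤ 1 / n := by
    have hcast : ((n - 1 : ℕ) : ℝ) = (n : ℝ) - 1 := by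
      rw [Nat.cast_sub (by omega)]
      simp
    have h0 : (0 : ℝ) ≤ 1 / n := by positivity
    have h1 : 1 - (μ : ℝ) ≤ (1 / (n : ℝ)) ^ (((n - 1 : ℕ) : ℝ)⁻¹) := by
      rw [hcast, ← one_div ((n : ℝ) - 1)]
      linarith
    calc (1 - (μ : ℝ)) ^ (n - 1) ≤ ((1 / (n : ℝ)) ^ (((n - 1 : ℕ) : ℝ)⁻¹)) ^ (n - 1) :=
          pow_le_pow_left₀ (by linarith) h1 _
      _ = 1 / n := Real.rpow_inv_natCast_pow h0 (by omega)
  obtain ⟨δ, hδ, hgap⟩ := PandoraSearch.exists_gap hn hμ0 hμ1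
  -- These bounds give `1 - β + c < μ * δ / 2`, hence `1 - z < δ` for the prior's reservation price
  -- `z`. The minimum with 1 keeps `β > 3 / 4` and `c < μ / 4`, so that `c < β * μ`.
  refine ⟨PandoraSearch.exists_isFrictionlessEquilibrium hn hμ0 hμ1,
    1 - (μ : ℝ) * min δ 1 / 4, ?_, (μ : ℝ) * min δ 1 / 4, ?_, fun β c hβ hβ1 hc hcc hβc => ?_⟩
  · have := lt_min hδ one_pos
    have : 0 < (μ : ℝ) * min δ 1 / 4 := by positivity
    linarith
  · have := lt_min hδ one_pos
    positivity
  have hmδ : (μ : ℝ) * min δ 1 ≤ μ * δ := mul_le_mul_of_nonneg_left (min_le_left _ _) hμ0.le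
  have hm1 : (μ : ℝ) * min δ 1 ≤ μ * 1 := mul_le_mul_of_nonneg_left (min_le_right _ _) hμ0.le
  have hβhalf : 3 / 4 < β := by linarith
  have hβ0 : 0 < β := by linarith
  have hcμ : c < β * μ := by nlinarith
  refine ⟨⟨_, PandoraSearch.exists_isFSPE hμ0 hpow hβ0 hβ1 hc hβc hcμ⟩, fun η hη F hF => ?_⟩
  obtain ⟨z, hz0, hz1, hz, hle⟩ :=
    PandoraSearch.le_searchUtility_of_isFSPE hβ0 hβ1 hc hβc hcμ hη (by omega)
  have hzδ : 1 - z < δ := by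
    have : (1 - z) * (μ : ℝ) < δ * μ := by nlinarith
    exact lt_of_mul_lt_mul_right this hμ0.le
  have hq0 : 0 ≤ (1 - (μ : ℝ)) ^ n := pow_nonneg (by linarith) n
  nlinarith [hgap F hF, mul_nonneg (sub_nonneg.2 hz1) hq0]
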